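/- **Setting.** A disk of *size* $a>0$ has radius $a^2$ and touches the $x$-axis from above in its *footpoint* $(f,0)$. A *placement* of $n\ge 1$ disks with given sizes assigns footpoints such that the interiors of the disks are pairwise disjoint; its *span* is the horizontal distance between the leftmost point and the rightmost point of any disk. The *optimum* is the smallest span of a placement of the given disks. Two disks of a placement are *consecutive* if no footpoint lies strictly between theirs. **Greedy algorithm.** Sort the disks by decreasing size. Place the first disk anywhere on the axis, and then place the remaining disks one by one in this order. Let $D$, of size $d$, be the next disk. 1. If for some consecutive disks $A,B$ of the current placement a disk of size $d$ can be put with its footpoint between those of $A$ and $B$ without overlapping $A$ or $B$, then choose such a pair and place $D$ between $A$ and $B$, touching the smaller one of the two. 2. Otherwise let $A$ and $Z$, of sizes $a$ and $z$, be the disks with the leftmost and the rightmost footpoint, and consider the position $D_A$, in which $D$ touches $A$ from the left, and the position $D_Z$, in which $D$ touches $Z$ from the right. 3. If one of $D_A$, $D_Z$ does not increase the span, then place $D$ in this way. 4. Otherwise place $D$ at $D_A$ if $a>z$, and at $D_Z$ otherwise. Choices left open by these rules (which gap, if several are large enough; which neighbour to touch, if $A$ and $B$ have equal size; which end, if neither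 increases the span) are arbitrary. **Model of computation.** Programs are fixed finite first-order functional programs working on values that are exact real numbers, $\mathrm{nil}$, or pairs of values, with rational constants. Every evaluation of a variable, constant, pairing, projection, arithmetic operation ($+,-,\cdot,/$), conditional ($x\le y$ for reals, or a test for $\mathrm{nil}$), local definition or function call costs one step, in addition to the steps of the parts that it evaluates. (Each step takes constant time on a real RAM.) The input is the list of the sizes in arbitrary order; the output is the list of the pairs (size, footpoint) of the disks. **Theorem.** For every finite nonempty family of disks of positive sizes, every outcome of the greedy algorithm is a valid placement whose span is at most $\tfrac43$ times the span of every placement of these disks, that is, at most $\tfrac43$ times the optimum. Moreover, the greedy algorithm can be implemented to run in time $O(n\log n)$: there are a program and a constant $C$ such that for every $n\ge1$ and all positive sizes of $n$ disks the program halts and outputs an outcome of the greedy algorithm for them, and if $n\ge2$, it does so after at most $C\,n\log n$ steps. -/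

import Mathlib

namespace Shelf

/-! ### Disks on a shelf, placements and span -/

/-- A disk lying on the `x`-axis: `size` is the square root of its radius, and `foot` is the
abscissa of its footpoint, the point in which it touches the axis from above. -/
@[ext]
structure Disk where
  size : ℝ
  foot : ℝ

namespace Disk

def radius (D : Disk) : ℝ := D.size ^ 2

/-- The disk touches the `x`-axis from above, so the height of its center is its radius. -/
noncomputable def center (D : Disk) : EuclideanSpace ℝ (Fin 2) := !₂[D.foot, D.radius]

/-- The interiors of the two disks are disjoint. -/
def NonOverlapping (D E : Disk) : Prop :=
  Disjoint (Metric.ball D.center D.radius) (Metric.ball E.center E.radius)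

/-- The two disks touch from outside. -/
def Touches (D E : Disk) : Prop :=
  dist D.center E.center = D.radius + E.radius

def leftmostPoint (D : Disk) : ℝ := D.foot - D.radius

def rightmostPoint (D : Disk) : ℝ := D.foot + D.radius

end Disk

/-- `p` is a valid placement of the disks whose sizes are listed (with multiplicity) in `S`. The
order of the list `p` carries no geometric meaning. -/
def IsPlacement (S : List ℝ) (p : List Disk) : Prop :=
  (p.map Disk.size).Perm S ∧ p.Pairwise Disk.NonOverlapping

/-- The horizontal distance between the leftmost point and the rightmost point of any disk
of a (nonempty) placement. -/
noncomputable def span (p : List Disk) : ℝ :=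
  sSup {x | ∃ D ∈ p, x = D.rightmostPoint} - sInf {x | ∃ D ∈ p, x = D.leftmostPoint}

/-- `p` is a `c`-approximate solution for the sizes `S`: a valid placement of them whose span is at
most `c` times the span of any valid placement of them, in particular of an optimal one. -/
def IsApproximation (c : ℝ) (S : List ℝ) (p : List Disk) : Prop :=
  IsPlacement S p ∧ ∀ q, IsPlacement S q → span p ≤ c * span q

/-! ### The greedy algorithm -/

/-- `A` and `B` are consecutive disks of `p`, with `A` to the left of `B`. -/
def Consecutive (p : List Disk) (A B : Disk) : Prop :=
  A ∈ p ∧ B ∈ p ∧ A.foot < B.foot ∧ ∀ E ∈ p, ¬ (A.foot < E.foot ∧ E.foot < B.foot)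

/-- A disk of size `d` can be put between `A` and `B` without overlapping either of them. -/
def FitsBetween (d : ℝ) (A B : Disk) : Prop :=
  ∃ D : Disk, D.size = d ∧ A.foot < D.foot ∧ D.foot < B.foot ∧
    D.NonOverlapping A ∧ D.NonOverlapping B

/-- No gap between consecutive disks of `p` is large enough for a disk of size `d`. -/
def NoGap (p : List Disk) (d : ℝ) : Prop :=
  ∀ A B, Consecutive p A B → ¬ FitsBetween d A B

/-- `A` is the disk of `p` with the leftmost footpoint. -/
def IsLeftmost (p : List Disk) (A : Disk) : Prop :=
  A ∈ p ∧ ∀ E ∈ p, A.foot ≤ E.foot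

/-- `Z` is the disk of `p` with the rightmost footpoint. -/
def IsRightmost (p : List Disk) (Z : Disk) : Prop :=
  Z ∈ p ∧ ∀ E ∈ p, E.foot ≤ Z.foot

/-- `L` is the candidate position of a disk of size `d` that touches `A` from the left. -/
def IsLeftCandidate (d : ℝ) (A L : Disk) : Prop :=
  L.size = d ∧ L.foot < A.foot ∧ L.Touches A

/-- `R` is the candidate position of a disk of size `d` that touches `Z` from the right. -/
def IsRightCandidate (d : ℝ) (Z R : Disk) : Prop :=
  R.size = d ∧ Z.foot < R.foot ∧ R.Touches Z

/-- `GreedyStep p D`: given the current placement `p`, the greedy algorithm may place the next disk,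
of size `D.size`, with footpoint `D.foot`. Choices that the algorithm leaves open (the position of
the first disk, the gap if several are large enough, the neighbor if both have the same size, the
end if neither increases the span) are left open here as well. -/
inductive GreedyStep (p : List Disk) (D : Disk) : Prop
  /-- The first disk may be placed anywhere. -/
  | first (hp : p = [])
  /-- The disk fits into a gap: it goes there, touching a smaller one of the two neighbors. -/
  | gap (A B : Disk) (hAB : Consecutive p A B) (hfit : FitsBetween D.size A B)
      (hl : A.foot < D.foot) (hr : D.foot < B.foot)
      (htouch : (A.size ≤ B.size ∧ D.Touches A) ∨ (B.size ≤ A.size ∧ D.Touches B))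
  /-- The disk fits into no gap, and some end candidate, namely `D`, does not increase the span. -/
  | freeEnd (A Z : Disk) (hgap : NoGap p D.size) (hA : IsLeftmost p A) (hZ : IsRightmost p Z)
      (hD : IsLeftCandidate D.size A D ∨ IsRightCandidate D.size Z D)
      (hspan : span (D :: p) ≤ span p)
  /-- The disk fits into no gap, and both end candidates `L` and `R` increase the span: it goes to
  the left end if the leftmost disk is larger than the rightmost one, and else to the right end. -/
  | growEnd (A Z L R : Disk) (hgap : NoGap p D.size) (hA : IsLeftmost p A) (hZ : IsRightmost p Z)
      (hL : IsLeftCandidate D.size A L) (hR : IsRightCandidate D.size Z R)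
      (hspanL : span p < span (L :: p)) (hspanR : span p < span (R :: p))
      (hD : (Z.size < A.size ∧ D = L) ∨ (A.size ≤ Z.size ∧ D = R))

/-- `GreedyFrom p T q`: starting from the placement `p` and processing the sizes in the list `T` one
by one, the greedy algorithm may end up with the placement `q`. -/
inductive GreedyFrom : List Disk → List ℝ → List Disk → Prop
  | done (p : List Disk) : GreedyFrom p [] p
  | place {p q : List Disk} {T : List ℝ} (D : Disk) :
      GreedyStep p D → GreedyFrom (D :: p) T q → GreedyFrom p (D.size :: T) q

/-- `p` is a possible outcome of the greedy algorithm on disks of the sizes `S`: the sizes are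
sorted in decreasing order and then processed one by one, starting from the empty placement. -/
def GreedyOutput (S : List ℝ) (p : List Disk) : Prop :=
  ∃ T : List ℝ, T.Perm S ∧ T.Pairwise (· ≥ ·) ∧ GreedyFrom [] T p

/-! ### The model of computation

First-order functional programs over exact real numbers with unit costs. Every value is a real
number, `nil`, or a pair of (pointers to) values, and every evaluation step can be carried out by a
bounded number of operations of a real RAM; there is no rounding of reals to integers. -/

inductive Value
  | nil
  | num (x : ℝ)
  | pair (u v : Value)

inductive Op
  | add
  | sub
  | mul
  | div

noncomputable def Op.apply : Op → ℝ → ℝ → ℝ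
  | .add, x, y => x + y
  | .sub, x, y => x - y
  | .mul, x, y => x * y
  | .div, x, y => x / y

/-- Division by zero is not allowed (the program gets stuck). -/
def Op.Allowed : Op → ℝ → Prop
  | .div, y => y ≠ 0
  | _, _ => True

inductive Term
  /-- The variable bound by the `i`-th innermost binder. -/
  | var (i : ℕ)
  | const (c : ℚ)
  | nil
  | pair (e₁ e₂ : Term)
  | fst (e : Term)
  | snd (e : Term)
  | arith (o : Op) (e₁ e₂ : Term)
  /-- `if e₁ ≤ e₂ then e₃ else e₄` for numbers `e₁` and `e₂`. -/
  | ifLe (e₁ e₂ e₃ e₄ : Term)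
  /-- `if e₁ is nil then e₂ else e₃`. -/
  | ifNil (e₁ e₂ e₃ : Term)
  /-- `let x := e₁; e₂`, where `x` is variable `0` of `e₂`. -/
  | bind (e₁ e₂ : Term)
  /-- Call of the `f`-th function of the program with argument `e`. -/
  | call (f : ℕ) (e : Term)

/-- A program is a finite list of function bodies. Each function has one argument, variable `0` of
its body, and may call all functions. Function `0` is the entry point. -/
abbrev Program := List Term

/-- `Eval P env e v t`: in program `P`, with the variables bound to the values in `env`, the term `e`
evaluates (call by value) to `v` in exactly `t` steps. Each evaluation of a term costs one step in
addition to the evaluation of its subterms and of the function body that it calls. -/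
inductive Eval (P : Program) : List Value → Term → Value → ℕ → Prop
  | var {env : List Value} {i : ℕ} {v : Value} (h : env[i]? = some v) : Eval P env (.var i) v 1
  | const {env : List Value} (c : ℚ) : Eval P env (.const c) (.num c) 1
  | nil {env : List Value} : Eval P env .nil .nil 1
  | pair {env : List Value} {e₁ e₂ : Term} {v₁ v₂ : Value} {t₁ t₂ : ℕ}
      (h₁ : Eval P env e₁ v₁ t₁) (h₂ : Eval P env e₂ v₂ t₂) :
      Eval P env (.pair e₁ e₂) (.pair v₁ v₂) (t₁ + t₂ + 1)
  | fst {env : List Value} {e : Term} {v₁ v₂ : Value} {t : ℕ}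
      (h : Eval P env e (.pair v₁ v₂) t) : Eval P env (.fst e) v₁ (t + 1)
  | snd {env : List Value} {e : Term} {v₁ v₂ : Value} {t : ℕ}
      (h : Eval P env e (.pair v₁ v₂) t) : Eval P env (.snd e) v₂ (t + 1)
  | arith {env : List Value} {o : Op} {e₁ e₂ : Term} {x y : ℝ} {t₁ t₂ : ℕ}
      (h₁ : Eval P env e₁ (.num x) t₁) (h₂ : Eval P env e₂ (.num y) t₂) (ho : o.Allowed y) :
      Eval P env (.arith o e₁ e₂) (.num (o.apply x y)) (t₁ + t₂ + 1)
  | ifLeTrue {env : List Value} {e₁ e₂ e₃ e₄ : Term} {x y : ℝ} {v : Value} {t₁ t₂ t₃ : ℕ}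
      (h₁ : Eval P env e₁ (.num x) t₁) (h₂ : Eval P env e₂ (.num y) t₂) (hxy : x ≤ y)
      (h₃ : Eval P env e₃ v t₃) : Eval P env (.ifLe e₁ e₂ e₃ e₄) v (t₁ + t₂ + t₃ + 1)
  | ifLeFalse {env : List Value} {e₁ e₂ e₃ e₄ : Term} {x y : ℝ} {v : Value} {t₁ t₂ t₄ : ℕ}
      (h₁ : Eval P env e₁ (.num x) t₁) (h₂ : Eval P env e₂ (.num y) t₂) (hxy : y < x)
      (h₄ : Eval P env e₄ v t₄) : Eval P env (.ifLe e₁ e₂ e₃ e₄) v (t₁ + t₂ + t₄ + 1)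
  | ifNilTrue {env : List Value} {e₁ e₂ e₃ : Term} {v : Value} {t₁ t₂ : ℕ}
      (h₁ : Eval P env e₁ .nil t₁) (h₂ : Eval P env e₂ v t₂) :
      Eval P env (.ifNil e₁ e₂ e₃) v (t₁ + t₂ + 1)
  | ifNilFalse {env : List Value} {e₁ e₂ e₃ : Term} {u v : Value} {t₁ t₃ : ℕ}
      (h₁ : Eval P env e₁ u t₁) (hu : u ≠ .nil) (h₃ : Eval P env e₃ v t₃) :
      Eval P env (.ifNil e₁ e₂ e₃) v (t₁ + t₃ + 1)
  | bind {env : List Value} {e₁ e₂ : Term} {u v : Value} {t₁ t₂ : ℕ}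
      (h₁ : Eval P env e₁ u t₁) (h₂ : Eval P (u :: env) e₂ v t₂) :
      Eval P env (.bind e₁ e₂) v (t₁ + t₂ + 1)
  | call {env : List Value} {f : ℕ} {e body : Term} {u v : Value} {t₁ t₂ : ℕ}
      (h₁ : Eval P env e u t₁) (hf : P[f]? = some body) (h₂ : Eval P [u] body v t₂) :
      Eval P env (.call f e) v (t₁ + t₂ + 1)

/-- On input `u`, the program `P` halts with output `v` after exactly `t` steps. -/
def Program.Outputs (P : Program) (u v : Value) (t : ℕ) : Prop :=
  Eval P [u] (.call 0 (.var 0)) v t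

/-- A list is represented by nested pairs, ending in `nil`. -/
def Value.ofList : List Value → Value
  | [] => .nil
  | v :: l => .pair v (Value.ofList l)

/-- The input of the algorithm: the list of the sizes, in arbitrary order. -/
def encodeSizes (S : List ℝ) : Value :=
  Value.ofList (S.map Value.num)

/-- The output of the algorithm: for each disk, its size and its footpoint. -/
def encodePlacement (p : List Disk) : Value :=
  Value.ofList (p.map fun D => Value.pair (Value.num D.size) (Value.num D.foot))

end Shelf

namespace Shelf

/-! ### Distances between footpoints -/

/-! Disks of sizes `a` and `b` have disjoint interiors iff their footpoints are at least `2ab`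
apart, with equality iff they touch. Let all sizes be at least `d`. Since `(a-d)(b-d) ≥ 0`, we have
`2ab ≥ (2ad-d²) + (2bd-d²)`, and `a² ≥ 2ad-d²` at the two ends; so every placement has span at least
`2∑(2ad-d²)` (`Packed.sum_le_span`). It therefore suffices to bound the greedy span by twice the sum
of the half-widths `4/3(2ad-d²)` (`halfWidth`). This is needed only after a step that increases the
span, with `d` the size of the disk just placed: in any other step the span stays, while the optimum
cannot decrease.

Before such a step no gap admits a disk of size `d`, so a gap between sizes `a` and `b` is shorter
than `2d(a+b)`. The half-widths of its two disks cover it if `a+b ≥ 4d` (`large_gap_le`) or if the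
disks touch (`tangent_gap_le`). Any other gap AB arose when the smaller disk B, with `2b ≤ a`, was
inserted so as to touch its other neighbour C. If a later disk filled the gap BC, then `a+b ≥ 4d`
after all. Otherwise AB and BC together are covered by their half-widths (`slack_gap_le`). Since B
is newer than C, no tangent gap has to compensate for wide gaps on both of its sides. The invariant
`Structured` records this history, and `exists_adjusted` carries out the compensation by shifting B.

If A and Z are the extreme disks, the span after the step is at most their footpoint distance plus
`2d(a+z) + 2d²`, since the candidate at the other end would protrude as well. The half-widths pay
for this if `a+z ≥ 3d`. Otherwise the smaller extreme disk has size below `3d/2`; then it touches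
its neighbour, and their gap has enough room to spare (`first_gap_le`). A lone small disk is treated
directly. All this is combined in `span_cons_le`.

For the running time, the sizes are kept in a leftist heap, and the gaps in another one, keyed by
the largest size that fits. The root of the latter decides whether any gap is large enough. Each
disk costs a bounded number of merges, and a merge takes logarithmic time. -/

theorem Disk.dist_center_sq (D E : Disk) :
    dist D.center E.center ^ 2 = (D.foot - E.foot) ^ 2 + (D.size ^ 2 - E.size ^ 2) ^ 2 := by
  rw [EuclideanSpace.dist_sq_eq]
  simp [Disk.center, Disk.radius, Real.dist_eq, sq_abs]

/-- By Pythagoras, the condition compares `(a²+b²)²` with the squared footpoint distance plus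
`(a²-b²)²`; the two squares differ by `(2ab)²`. -/
theorem Disk.nonOverlapping_iff {D E : Disk} (hD : 0 < D.size) (hE : 0 < E.size) :
    D.NonOverlapping E ↔ 2 * D.size * E.size ≤ |D.foot - E.foot| := by
  have hD' : 0 < D.radius := by unfold Disk.radius; positivity
  have hE' : 0 < E.radius := by unfold Disk.radius; positivity
  have hp : 0 < D.size * E.size := mul_pos hD hE
  rw [Disk.NonOverlapping, disjoint_ball_ball_iff hD' hE',
    ← sq_le_sq₀ (by positivity) dist_nonneg, Disk.dist_center_sq,
    ← sq_le_sq₀ (a := 2 * D.size * E.size) (by nlinarith) (abs_nonneg _), sq_abs]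
  unfold Disk.radius
  constructor <;> intro h <;> nlinarith

theorem Disk.touches_iff {D E : Disk} (hD : 0 < D.size) (hE : 0 < E.size) :
    D.Touches E ↔ |D.foot - E.foot| = 2 * D.size * E.size := by
  have hp : 0 < D.size * E.size := mul_pos hD hE
  rw [Disk.Touches, ← sq_eq_sq₀ dist_nonneg (by unfold Disk.radius; positivity),
    Disk.dist_center_sq, ← sq_eq_sq₀ (a := |D.foot - E.foot|) (abs_nonneg _) (by nlinarith), sq_abs]
  unfold Disk.radius
  constructor <;> intro h <;> nlinarith

/-! ### The span -/

theorem exists_mem_isMax {p : List Disk} (hp : p ≠ []) (g : Disk → ℝ) :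
    ∃ D ∈ p, ∀ E ∈ p, g E ≤ g D := by
  obtain ⟨D, hD⟩ := List.exists_mem_of_ne_nil p hp
  exact Set.exists_max_image {D | D ∈ p} g (List.finite_toSet p) ⟨D, hD⟩

theorem span_eq {p : List Disk} {l r : ℝ} (hr : ∀ D ∈ p, D.rightmostPoint ≤ r)
    (hr' : ∃ D ∈ p, D.rightmostPoint = r) (hl : ∀ D ∈ p, l ≤ D.leftmostPoint)
    (hl' : ∃ D ∈ p, D.leftmostPoint = l) : span p = r - l := by
  have h1 : IsGreatest {x | ∃ D ∈ p, x = D.rightmostPoint} r := by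
    refine ⟨?_, ?_⟩
    · obtain ⟨D, h, e⟩ := hr'; exact ⟨D, h, e.symm⟩
    · rintro x ⟨D, h, rfl⟩; exact hr D h
  have h2 : IsLeast {x | ∃ D ∈ p, x = D.leftmostPoint} l := by
    refine ⟨?_, ?_⟩
    · obtain ⟨D, h, e⟩ := hl'; exact ⟨D, h, e.symm⟩
    · rintro x ⟨D, h, rfl⟩; exact hl D h
  rw [span, h1.csSup_eq, h2.csInf_eq]

/-- `l` and `r` are the abscissae of the leftmost and the rightmost point of the disks in `p`. -/
structure Extent (p : List Disk) (l r : ℝ) : Prop where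
  right_le : ∀ D ∈ p, D.rightmostPoint ≤ r
  exists_right : ∃ D ∈ p, D.rightmostPoint = r
  le_left : ∀ D ∈ p, l ≤ D.leftmostPoint
  exists_left : ∃ D ∈ p, D.leftmostPoint = l

theorem Extent.span_eq {p : List Disk} {l r : ℝ} (h : Extent p l r) : span p = r - l :=
  Shelf.span_eq h.1 h.2 h.3 h.4

theorem exists_extent {p : List Disk} (hp : p ≠ []) : ∃ l r, Extent p l r := by
  obtain ⟨D, hD, h⟩ := exists_mem_isMax hp Disk.rightmostPoint
  obtain ⟨E, hE, h'⟩ := exists_mem_isMax hp (fun D => - D.leftmostPoint)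
  exact ⟨_, _, h, ⟨D, hD, rfl⟩, fun F hF => by simpa using h' F hF, ⟨E, hE, rfl⟩⟩

theorem Extent.cons {p : List Disk} {l r : ℝ} (h : Extent p l r) (D : Disk) :
    Extent (D :: p) (min l D.leftmostPoint) (max r D.rightmostPoint) := by
  obtain ⟨h1, ⟨X, hX, rX⟩, h3, ⟨Y, hY, lY⟩⟩ := h
  refine ⟨?_, ?_, ?_, ?_⟩
  · intro E hE
    rcases List.mem_cons.1 hE with rfl | hE
    · exact le_max_right _ _
    · exact (h1 E hE).trans (le_max_left _ _)
  · rcases max_choice r D.rightmostPoint with e | e <;> rw [e]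
    · exact ⟨X, by simp [hX], rX⟩
    · exact ⟨D, by simp, rfl⟩
  · intro E hE
    rcases List.mem_cons.1 hE with rfl | hE
    · exact min_le_right _ _
    · exact (min_le_left _ _).trans (h3 E hE)
  · rcases min_choice l D.leftmostPoint with e | e <;> rw [e]
    · exact ⟨Y, by simp [hY], lY⟩
    · exact ⟨D, by simp, rfl⟩

theorem Extent.span_cons {p : List Disk} {l r : ℝ} (h : Extent p l r) (D : Disk) :
    span (D :: p) = max r D.rightmostPoint - min l D.leftmostPoint :=
  (h.cons D).span_eq

theorem span_perm {p q : List Disk} (h : p.Perm q) : span p = span q := by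
  simp only [span, h.mem_iff]

theorem span_le_span_cons {p : List Disk} (hp : p ≠ []) (D : Disk) : span p ≤ span (D :: p) := by
  obtain ⟨l, r, h⟩ := exists_extent hp
  rw [h.span_eq, h.span_cons]
  linarith [le_max_left r D.rightmostPoint, min_le_left l D.leftmostPoint]

/-! ### Consecutive disks in either direction -/

/-- The abscissa of the footpoint for one of the two orientations of the axis. -/
def IsDirection (φ : Disk → ℝ) : Prop := φ = Disk.foot ∨ φ = -Disk.foot

theorem isDirection_foot : IsDirection Disk.foot := .inl rfl

theorem IsDirection.neg {φ : Disk → ℝ} (h : IsDirection φ) : IsDirection (-φ) := by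
  rcases h with rfl | rfl
  · exact .inr rfl
  · exact .inl (neg_neg _)

theorem IsDirection.abs_sub {φ : Disk → ℝ} (h : IsDirection φ) (A B : Disk) :
    |A.foot - B.foot| = |φ A - φ B| := by
  rcases h with rfl | rfl
  · rfl
  · simp only [Pi.neg_apply]; rw [neg_sub_neg, abs_sub_comm]

theorem IsDirection.eq_or_eq_neg {φ ψ : Disk → ℝ} (h : IsDirection φ) (h' : IsDirection ψ) :
    ψ = φ ∨ ψ = -φ := by
  rcases h with rfl | rfl <;> rcases h' with rfl | rfl <;> simp

/-- `B` is the next disk of `p` after `A` with respect to `φ`. -/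
def Next (φ : Disk → ℝ) (p : List Disk) (A B : Disk) : Prop :=
  A ∈ p ∧ B ∈ p ∧ φ A < φ B ∧ ∀ E ∈ p, ¬ (φ A < φ E ∧ φ E < φ B)

/-- `A` is the first disk of `p` with respect to `φ`. -/
def First (φ : Disk → ℝ) (p : List Disk) (A : Disk) : Prop :=
  A ∈ p ∧ ∀ E ∈ p, φ A ≤ φ E

theorem next_foot_iff {p : List Disk} {A B : Disk} : Next Disk.foot p A B ↔ Consecutive p A B :=
  Iff.rfl

theorem first_foot_iff {p : List Disk} {A : Disk} : First Disk.foot p A ↔ IsLeftmost p A :=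
  Iff.rfl

theorem first_neg_foot_iff {p : List Disk} {A : Disk} :
    First (-Disk.foot) p A ↔ IsRightmost p A := by
  simp [First, IsRightmost]

theorem next_neg_iff {φ : Disk → ℝ} {p : List Disk} {A B : Disk} :
    Next (-φ) p A B ↔ Next φ p B A := by
  simp only [Next, Pi.neg_apply, neg_lt_neg_iff]
  constructor
  · rintro ⟨h1, h2, h3, h4⟩
    exact ⟨h2, h1, h3, fun E hE h => h4 E hE ⟨h.2, h.1⟩⟩
  · rintro ⟨h1, h2, h3, h4⟩
    exact ⟨h2, h1, h3, fun E hE h => h4 E hE ⟨h.2, h.1⟩⟩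

theorem Next.cons {φ : Disk → ℝ} {p : List Disk} {A B D : Disk} (h : Next φ p A B)
    (hD : ¬ (φ A < φ D ∧ φ D < φ B)) : Next φ (D :: p) A B := by
  refine ⟨by simp [h.1], by simp [h.2.1], h.2.2.1, fun E hE => ?_⟩
  rcases List.mem_cons.1 hE with rfl | hE
  · exact hD
  · exact h.2.2.2 E hE

theorem Next.of_cons {φ : Disk → ℝ} {p : List Disk} {A B D : Disk} (h : Next φ (D :: p) A B)
    (hA : A ≠ D) (hB : B ≠ D) : Next φ p A B :=
  ⟨(List.mem_cons.1 h.1).resolve_left hA, (List.mem_cons.1 h.2.1).resolve_left hB, h.2.2.1,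
    fun E hE => h.2.2.2 E (by simp [hE])⟩

theorem exists_first {p : List Disk} (hp : p ≠ []) (φ : Disk → ℝ) : ∃ A, First φ p A := by
  obtain ⟨A, hA, h⟩ := exists_mem_isMax hp (-φ)
  exact ⟨A, hA, fun E hE => by simpa using h E hE⟩

/-- Distances between consecutive disks add up. -/
theorem sub_le_of_next_le {φ : Disk → ℝ} {g h : Disk → ℝ} :
    ∀ (n : ℕ) (p : List Disk), p.length = n → p.Pairwise (fun A B => φ A ≠ φ B) →
      (∀ A B, Next φ p A B → g B - g A ≤ h A + h B) → ∀ A Z, First φ p A → First (-φ) p Z →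
      g Z - g A ≤ 2 * (p.map h).sum - h A - h Z := by
  intro n
  induction n with
  | zero =>
    intro p hp _ _ A Z hA
    rw [List.length_eq_zero_iff] at hp
    subst hp
    simp [First] at hA
  | succ n ih =>
    intro p hp hinj hnext A Z hA hZ
    -- Induction by removing the last disk `Z`: its predecessor `Y` becomes the last one, and the
    -- other consecutive pairs persist. Only the order comes from `φ`; the telescoping is done with
    -- `g`.
    obtain ⟨s, t, rfl⟩ := List.append_of_mem hZ.1
    have hperm : (s ++ Z :: t).Perm (Z :: (s ++ t)) := List.perm_middle
    have hinj' : (Z :: (s ++ t)).Pairwise (fun A B => φ A ≠ φ B) :=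
      hinj.perm hperm (fun h => h.symm)
    rw [(hperm.map h).sum_eq]
    have hlt : ∀ E ∈ s ++ t, φ E < φ Z := fun E hE =>
      lt_of_le_of_ne (by simpa using hZ.2 E (hperm.mem_iff.2 (by simp [hE])))
        ((List.pairwise_cons.1 hinj').1 E hE).symm
    by_cases he : s ++ t = []
    · rw [he] at hperm ⊢
      have : A = Z := by simpa using hperm.mem_iff.1 hA.1
      subst this
      simp; linarith
    · obtain ⟨Y, hY⟩ := exists_first he (-φ)
      have hYZ : Next φ (s ++ Z :: t) Y Z := by
        refine ⟨hperm.mem_iff.2 (by simp [hY.1]), hZ.1, hlt Y hY.1, fun E hE hh => ?_⟩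
        rcases List.mem_cons.1 (hperm.mem_iff.1 hE) with rfl | hE
        · exact lt_irrefl _ hh.2
        · have := hY.2 E hE
          simp only [Pi.neg_apply, neg_le_neg_iff] at this
          exact hh.1.not_ge this
      have hA' : First φ (s ++ t) A := by
        refine ⟨?_, fun E hE => hA.2 E (hperm.mem_iff.2 (by simp [hE]))⟩
        rcases List.mem_cons.1 (hperm.mem_iff.1 hA.1) with rfl | hA1
        · have h1 := hA.2 Y hYZ.1
          exact absurd h1 (hlt Y hY.1).not_ge
        · exact hA1
      have key := ih (s ++ t) (by have := hperm.length_eq; simp at this hp ⊢; omega)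
        (List.pairwise_cons.1 hinj').2 (fun B C hBC => hnext B C ?_) A Y hA' hY
      · have := hnext Y Z hYZ
        simp only [List.map_cons, List.sum_cons]
        linarith
      · refine ⟨hperm.mem_iff.2 (by simp [hBC.1]), hperm.mem_iff.2 (by simp [hBC.2.1]),
          hBC.2.2.1, fun E hE hh => ?_⟩
        rcases List.mem_cons.1 (hperm.mem_iff.1 hE) with rfl | hE
        · exact (hlt C hBC.2.1).not_gt hh.2
        · exact hBC.2.2.2 E hE hh

/-! ### Packed disks and the lower bound for the span -/

/-- The disks in `p` have size at least `d` and do not overlap. -/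
structure Packed (p : List Disk) (d : ℝ) : Prop where
  pos : 0 < d
  le_size : ∀ D ∈ p, d ≤ D.size
  sep : p.Pairwise fun A B => 2 * A.size * B.size ≤ |A.foot - B.foot|

theorem Packed.size_pos {p : List Disk} {d : ℝ} (h : Packed p d) {D : Disk} (hD : D ∈ p) :
    0 < D.size := h.pos.trans_le (h.le_size D hD)

theorem Packed.ne {p : List Disk} {d : ℝ} (h : Packed p d) {φ : Disk → ℝ} (hφ : IsDirection φ) :
    p.Pairwise fun A B => φ A ≠ φ B := by
  refine h.sep.imp_of_mem fun {A B} hA hB hAB he => ?_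
  rw [hφ.abs_sub, he, sub_self, abs_zero] at hAB
  nlinarith [mul_pos (h.size_pos hA) (h.size_pos hB)]

theorem Packed.inj {p : List Disk} {d : ℝ} (h : Packed p d) {φ : Disk → ℝ} (hφ : IsDirection φ)
    {A B : Disk} (hA : A ∈ p) (hB : B ∈ p) (hAB : φ A = φ B) : A = B := by
  by_contra hne
  have : Std.Symm fun A B : Disk => φ A ≠ φ B := ⟨fun _ _ h => h.symm⟩
  exact (h.ne hφ).forall hA hB hne hAB

theorem Packed.le_abs_sub {p : List Disk} {d : ℝ} (h : Packed p d) {A B : Disk} (hA : A ∈ p)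
    (hB : B ∈ p) (hAB : A ≠ B) : 2 * A.size * B.size ≤ |A.foot - B.foot| := by
  have : Std.Symm fun A B : Disk => 2 * A.size * B.size ≤ |A.foot - B.foot| :=
    ⟨fun A B h => by rw [abs_sub_comm]; linarith⟩
  exact h.sep.forall hA hB hAB

theorem Packed.le_sub {p : List Disk} {d : ℝ} (h : Packed p d) {φ : Disk → ℝ}
    (hφ : IsDirection φ) {A B : Disk} (hA : A ∈ p) (hB : B ∈ p) (hAB : φ A < φ B) :
    2 * A.size * B.size ≤ φ B - φ A := by
  have := h.le_abs_sub hA hB (by rintro rfl; exact lt_irrefl _ hAB)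
  rwa [hφ.abs_sub, abs_sub_comm, abs_of_pos (sub_pos.2 hAB)] at this

theorem Packed.nodup {p : List Disk} {d : ℝ} (h : Packed p d) : p.Nodup :=
  (h.ne isDirection_foot).imp fun h' => by rintro rfl; exact h' rfl

theorem Packed.mono {p : List Disk} {d d' : ℝ} (h : Packed p d) (hd : 0 < d') (hle : d' ≤ d) :
    Packed p d' :=
  ⟨hd, fun D hD => hle.trans (h.le_size D hD), h.sep⟩

theorem packed_of_pairwise {p : List Disk} {d : ℝ} (hd : 0 < d) (hp : ∀ D ∈ p, d ≤ D.size)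
    (h : p.Pairwise Disk.NonOverlapping) : Packed p d :=
  ⟨hd, hp, h.imp_of_mem fun hA hB hAB =>
    (Disk.nonOverlapping_iff (hd.trans_le (hp _ hA)) (hd.trans_le (hp _ hB))).1 hAB⟩

theorem Packed.pairwise {p : List Disk} {d : ℝ} (h : Packed p d) :
    p.Pairwise Disk.NonOverlapping :=
  h.sep.imp_of_mem fun hA hB hAB =>
    (Disk.nonOverlapping_iff (h.size_pos hA) (h.size_pos hB)).2 hAB

/-- Disks of size at least `d` take a span of at least `4 * a * d - 2 * d ^ 2` per disk. -/
theorem Packed.sum_le_span {p : List Disk} {d : ℝ} (h : Packed p d) (hp : p ≠ []) :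
    2 * (p.map fun A => 2 * A.size * d - d ^ 2).sum ≤ span p := by
  obtain ⟨l, r, hlr⟩ := exists_extent hp
  obtain ⟨A, hA⟩ := exists_first hp Disk.foot
  obtain ⟨Z, hZ⟩ := exists_first hp (-Disk.foot)
  -- The signs of `g` and `h` turn the telescoped upper bound into a lower bound. The hypothesis on
  -- consecutive disks is `(b-d)(c-d) ≥ 0`.
  have key := sub_le_of_next_le (g := -Disk.foot) (h := fun A => -(2 * A.size * d - d ^ 2))
    _ p rfl (h.ne isDirection_foot) (fun B C hBC => by
      have h1 := h.le_sub isDirection_foot hBC.1 hBC.2.1 hBC.2.2.1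
      have h2 := h.le_size _ hBC.1
      have h3 := h.le_size _ hBC.2.1
      simp only [Pi.neg_apply]
      nlinarith [mul_nonneg (sub_nonneg.2 h2) (sub_nonneg.2 h3)]) A Z hA hZ
  have e : (p.map fun A => -(2 * A.size * d - d ^ 2)).sum =
      -(p.map fun A => 2 * A.size * d - d ^ 2).sum := by
    clear key hA hZ hlr h hp
    induction p with
    | nil => simp
    | cons B p ih => simp only [List.map_cons, List.sum_cons, ih]; ring
  rw [e] at key
  rw [hlr.span_eq]
  have h1 := hlr.1 Z hZ.1
  have h2 := hlr.3 A hA.1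
  simp only [Disk.rightmostPoint, Disk.leftmostPoint, Disk.radius, Pi.neg_apply] at h1 h2 key
  -- At the ends, the radius `a²` is at least `2ad-d²`.
  nlinarith [sq_nonneg (A.size - d), sq_nonneg (Z.size - d)]

/-! ### Structure of the placements that the greedy algorithm builds -/

def Tangent (A B : Disk) : Prop := |A.foot - B.foot| = 2 * A.size * B.size

theorem Tangent.symm {A B : Disk} (h : Tangent A B) : Tangent B A := by
  unfold Tangent at *
  rw [abs_sub_comm, h]; ring

theorem Tangent.sub_eq {A B : Disk} (h : Tangent A B) {φ : Disk → ℝ} (hφ : IsDirection φ)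
    (hAB : φ A < φ B) : φ B - φ A = 2 * A.size * B.size := by
  rw [Tangent, hφ.abs_sub, abs_sub_comm, abs_of_pos (sub_pos.2 hAB)] at h
  exact h

theorem tangent_of_sub_eq {A B : Disk} {φ : Disk → ℝ} (hφ : IsDirection φ) (hA : 0 < A.size)
    (hB : 0 < B.size) (h : φ B - φ A = 2 * A.size * B.size) : Tangent A B := by
  have : 0 < A.size * B.size := mul_pos hA hB
  rw [Tangent, hφ.abs_sub, abs_sub_comm, h, abs_of_pos]
  nlinarith

/-- The gap between the consecutive disks `A` and `B` arose when the smaller disk `B` was put next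
to an older disk `C`, which it still touches unless `A` and `B` are large compared to `d`. -/
def Slack (φ : Disk → ℝ) (p : List Disk) (d : ℝ) (A B : Disk) : Prop :=
  2 * B.size ≤ A.size ∧ (d * (A.size + B.size) ≤ A.size * B.size ∨
    ∃ C, Next φ p B C ∧ Tangent B C ∧ B.size ≤ C.size ∧ C.size ≤ A.size ∧ [B, C].Sublist p)

/-- Either kind of gap between consecutive disks. -/
def Gap (φ : Disk → ℝ) (p : List Disk) (d : ℝ) (A B : Disk) : Prop :=
  Tangent A B ∨ Slack φ p d A B ∨ Slack (-φ) p d B A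

theorem Gap.neg {φ : Disk → ℝ} {p : List Disk} {d : ℝ} {A B : Disk} (h : Gap φ p d A B) :
    Gap (-φ) p d B A := by
  rcases h with h | h | h
  · exact .inl h.symm
  · exact .inr (.inr (by rwa [neg_neg]))
  · exact .inr (.inl h)

/-- The structure of a placement that the greedy algorithm builds from disks of size
at least `d`. -/
structure Structured (p : List Disk) (d : ℝ) : Prop extends Packed p d where
  gap : ∀ φ, IsDirection φ → ∀ A B, Next φ p A B → Gap φ p d A B
  -- If all sizes are at least `d` and `A` is smaller than `3d/2`, this forces `A` to touch `B` and
  -- excludes that `B` is the smaller disk of a wide gap.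
  first : ∀ φ, IsDirection φ → ∀ A B, First φ p A → Next φ p A B →
    2 * B.size ≤ A.size ∨ (Tangent A B ∧ ∀ C, Next φ p B C →
      Tangent B C ∨ 2 * C.size ≤ B.size ∨ B.size * (A.size + C.size) ≤ A.size * C.size)

/-- If the tangent gap BC has been filled, then, for positive `d'`, `1/d' ≥ 1/b + 1/c ≥ 1/b + 1/a`
because `c ≤ a`; this is the first alternative of `Slack`. -/
theorem Slack.weaken {φ : Disk → ℝ} {p : List Disk} {d d' : ℝ} {A B D : Disk}
    (h : Slack φ p d A B) (hd : d' ≤ d) (hA : 0 < A.size) (hB : 0 < B.size)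
    (hC : ∀ C, Next φ p B C → Tangent B C → Next φ (D :: p) B C ∨
      d' * (B.size + C.size) ≤ B.size * C.size) (hpos : ∀ C ∈ p, 0 < C.size) :
    Slack φ (D :: p) d' A B := by
  refine ⟨h.1, ?_⟩
  rcases h.2 with h2 | ⟨C, h1, h2, h3, h4, h5⟩
  · exact .inl ((mul_le_mul_of_nonneg_right hd (by positivity)).trans h2)
  · rcases hC C h1 h2 with h6 | h6
    · exact .inr ⟨C, h6, h2, h3, h4, h5.cons _⟩
    · left
      have hC' := hpos C h1.2.1
      have h7 : d' * (B.size + C.size) * A.size ≤ B.size * C.size * A.size :=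
        mul_le_mul_of_nonneg_right h6 hA.le
      by_cases h8 : d' * B.size ≤ 0
      · have : d' ≤ 0 := by
          by_contra! h9
          exact absurd (mul_pos h9 hB) h8.not_gt
        nlinarith [mul_pos hA hB]
      · push Not at h8
        have h9 : d' * B.size * C.size ≤ d' * B.size * A.size :=
          mul_le_mul_of_nonneg_left h4 h8.le
        have h10 : C.size * (d' * (A.size + B.size)) ≤ C.size * (A.size * B.size) := by nlinarith
        exact le_of_mul_le_mul_left h10 hC'

theorem Slack.mono {φ : Disk → ℝ} {p : List Disk} {d d' : ℝ} {A B : Disk}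
    (h : Slack φ p d A B) (hd : d' ≤ d) (hA : 0 < A.size) (hB : 0 < B.size) :
    Slack φ p d' A B :=
  ⟨h.1, h.2.imp_left fun h2 => (mul_le_mul_of_nonneg_right hd (by positivity)).trans h2⟩

theorem Structured.mono {p : List Disk} {d d' : ℝ} (h : Structured p d) (hd : 0 < d')
    (hle : d' ≤ d) : Structured p d' where
  toPacked := h.toPacked.mono hd hle
  gap φ hφ A B hAB := by
    have hA := h.size_pos hAB.1
    have hB := h.size_pos hAB.2.1
    rcases h.gap φ hφ A B hAB with h1 | h1 | h1
    · exact .inl h1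
    · exact .inr (.inl (h1.mono hle hA hB))
    · exact .inr (.inr (h1.mono hle hB hA))
  first := h.first

/-- `D` is put between `A` and `B`, touching the smaller disk `B`. -/
def InsertStep (φ : Disk → ℝ) (p : List Disk) (D A B : Disk) : Prop :=
  Next φ p A B ∧ B.size ≤ A.size ∧ φ B - φ D = 2 * D.size * B.size ∧
    2 * A.size * D.size ≤ φ D - φ A

/-- `D` is put in front of the first disk `A`, touching it. -/
def EndStep (φ : Disk → ℝ) (p : List Disk) (D A : Disk) : Prop :=
  First φ p A ∧ φ A - φ D = 2 * D.size * A.size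

/-! ### Effect of a single step on the consecutive pairs and on the invariant -/

section steps

variable {φ : Disk → ℝ} {p : List Disk} {A B D : Disk}

theorem InsertStep.lt (h : Packed p D.size) (hs : InsertStep φ p D A B) :
    φ A < φ D ∧ φ D < φ B := by
  obtain ⟨h1, h2, h3, h4⟩ := hs
  have hA := mul_pos (h.size_pos h1.1) h.pos
  have hB := mul_pos h.pos (h.size_pos h1.2.1)
  constructor <;> nlinarith

theorem EndStep.lt (h : Packed p D.size) (hs : EndStep φ p D A) {E : Disk} (hE : E ∈ p) :
    φ D < φ E := by
  have hA := mul_pos h.pos (h.size_pos hs.1.1)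
  have := hs.1.2 E hE
  have := hs.2
  nlinarith

theorem packed_cons (h : Packed p D.size) (hφ : IsDirection φ)
    (hD : ∀ E ∈ p, 2 * D.size * E.size ≤ |φ D - φ E|) : Packed (D :: p) D.size := by
  refine ⟨h.pos, ?_, ?_⟩
  · intro E hE
    rcases List.mem_cons.1 hE with rfl | hE
    · exact le_rfl
    · exact h.le_size E hE
  · refine List.pairwise_cons.2 ⟨fun E hE => ?_, h.sep⟩
    rw [hφ.abs_sub]
    exact hD E hE

/-- Only the two neighbours matter: a disk of size `e` beyond `A` is already `2ea ≥ 2ed` away from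
`A`, and likewise beyond `B`. -/
theorem InsertStep.packed (h : Packed p D.size) (hφ : IsDirection φ)
    (hs : InsertStep φ p D A B) : Packed (D :: p) D.size := by
  obtain ⟨hAD, hDB⟩ := hs.lt h
  obtain ⟨h1, h2, h3, h4⟩ := hs
  refine packed_cons h hφ fun E hE => ?_
  have hE' := h.size_pos hE
  have hd := h.pos
  have hdA := h.le_size A h1.1
  have hdB := h.le_size B h1.2.1
  rcases le_or_gt (φ E) (φ A) with hEA | hEA
  · rw [abs_of_nonneg (by linarith)]
    rcases hEA.eq_or_lt with e | hEA
    · obtain rfl := h.inj hφ hE h1.1 e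
      nlinarith
    · have := h.le_sub hφ hE h1.1 hEA
      nlinarith [mul_le_mul_of_nonneg_right hdA hE'.le, mul_pos hd (h.size_pos h1.1)]
  · have hEB : φ B ≤ φ E := by
      by_contra! hc
      exact h1.2.2.2 E hE ⟨hEA, hc⟩
    rw [abs_sub_comm, abs_of_nonneg (by linarith)]
    rcases hEB.eq_or_lt with e | hEB
    · obtain rfl := h.inj hφ h1.2.1 hE e
      exact h3.ge
    · have := h.le_sub hφ h1.2.1 hE hEB
      nlinarith [mul_le_mul_of_nonneg_right hdB hE'.le, mul_pos hd (h.size_pos h1.2.1)]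

theorem EndStep.packed (h : Packed p D.size) (hφ : IsDirection φ)
    (hs : EndStep φ p D A) : Packed (D :: p) D.size := by
  refine packed_cons h hφ fun E hE => ?_
  rw [abs_sub_comm, abs_of_pos (sub_pos.2 (hs.lt h hE))]
  obtain ⟨h1, h2⟩ := hs
  rcases (h1.2 E hE).eq_or_lt with e | hlt
  · obtain rfl := h.inj hφ h1.1 hE e
    exact h2.ge
  · have := h.le_sub hφ h1.1 hE hlt
    have hE' := h.size_pos hE
    nlinarith [mul_le_mul_of_nonneg_right (h.le_size A h1.1) hE'.le,
      mul_pos h.pos (h.size_pos h1.1)]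

theorem InsertStep.next_left (h : Packed p D.size) (hs : InsertStep φ p D A B) :
    Next φ (D :: p) A D := by
  obtain ⟨hAD, hDB⟩ := hs.lt h
  refine ⟨by simp [hs.1.1], by simp, hAD, fun E hE hh => ?_⟩
  rcases List.mem_cons.1 hE with rfl | hE
  · exact lt_irrefl _ hh.2
  · exact hs.1.2.2.2 E hE ⟨hh.1, hh.2.trans hDB⟩

theorem InsertStep.next_right (h : Packed p D.size) (hs : InsertStep φ p D A B) :
    Next φ (D :: p) D B := by
  obtain ⟨hAD, hDB⟩ := hs.lt h
  refine ⟨by simp, by simp [hs.1.2.1], hDB, fun E hE hh => ?_⟩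
  rcases List.mem_cons.1 hE with rfl | hE
  · exact lt_irrefl _ hh.1
  · exact hs.1.2.2.2 E hE ⟨hAD.trans hh.1, hh.2⟩

theorem EndStep.next (h : Packed p D.size) (hs : EndStep φ p D A) : Next φ (D :: p) D A := by
  refine ⟨by simp, by simp [hs.1.1], hs.lt h hs.1.1, fun E hE hh => ?_⟩
  rcases List.mem_cons.1 hE with rfl | hE
  · exact lt_irrefl _ hh.1
  · exact (hs.1.2 E hE).not_gt hh.2

/-- Each disk has at most one successor. -/
theorem Next.unique_right {d : ℝ} (h : Packed p d) (hφ : IsDirection φ) {C : Disk}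
    (hB : Next φ p A B) (hC : Next φ p A C) : B = C := by
  refine h.inj hφ hB.2.1 hC.2.1 (le_antisymm ?_ ?_)
  · by_contra! hlt
    exact hB.2.2.2 C hC.2.1 ⟨hC.2.2.1, hlt⟩
  · by_contra! hlt
    exact hC.2.2.2 B hB.2.1 ⟨hB.2.2.1, hlt⟩

theorem Next.unique_left {d : ℝ} (h : Packed p d) (hφ : IsDirection φ) {C : Disk}
    (hA : Next φ p A B) (hC : Next φ p C B) : A = C :=
  Next.unique_right h hφ.neg (next_neg_iff.2 hA) (next_neg_iff.2 hC)

theorem InsertStep.next_cases (h : Packed p D.size) (hφ : IsDirection φ)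
    (hs : InsertStep φ p D A B) {X Y : Disk} (hXY : Next φ (D :: p) X Y) :
    (X = A ∧ Y = D) ∨ (X = D ∧ Y = B) ∨ (X ≠ D ∧ Y ≠ D ∧ Next φ p X Y ∧ X ≠ A ∧ Y ≠ B) := by
  have h' := hs.packed h hφ
  by_cases hX : X = D
  · subst hX
    exact .inr (.inl ⟨rfl, hXY.unique_right h' hφ (hs.next_right h)⟩)
  · by_cases hY : Y = D
    · subst hY
      exact .inl ⟨hXY.unique_left h' hφ (hs.next_left h), rfl⟩
    · refine .inr (.inr ⟨hX, hY, hXY.of_cons hX hY, ?_, ?_⟩)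
      · rintro rfl
        exact hY (hXY.unique_right h' hφ (hs.next_left h))
      · rintro rfl
        exact hX (hXY.unique_left h' hφ (hs.next_right h))

theorem EndStep.next_cases (h : Packed p D.size) (hφ : IsDirection φ)
    (hs : EndStep φ p D A) {X Y : Disk} (hXY : Next φ (D :: p) X Y) :
    (X = D ∧ Y = A) ∨ (X ≠ D ∧ Y ≠ D ∧ Next φ p X Y) := by
  by_cases hX : X = D
  · subst hX
    exact .inl ⟨rfl, hXY.unique_right (hs.packed h hφ) hφ (hs.next h)⟩
  · have hY : Y ≠ D := by
      rintro rfl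
      exact (hs.lt h ((List.mem_cons.1 hXY.1).resolve_left hX)).not_gt hXY.2.2.1
    exact .inr ⟨hX, hY, hXY.of_cons hX hY⟩

/-- An old gap that is not filled persists. -/
theorem InsertStep.next_cons (h : Packed p D.size) (hφ : IsDirection φ)
    (hs : InsertStep φ p D A B) {X Y : Disk} (hXY : Next φ p X Y) (hX : X ≠ A) :
    Next φ (D :: p) X Y := by
  refine hXY.cons fun hh => ?_
  obtain ⟨hAD, hDB⟩ := hs.lt h
  have h1 : φ X ≤ φ A := by
    by_contra! hc
    exact hs.1.2.2.2 X hXY.1 ⟨hc, hh.1.trans hDB⟩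
  rcases h1.eq_or_lt with e | h1
  · exact hX (h.inj hφ hXY.1 hs.1.1 e)
  · exact hXY.2.2.2 A hs.1.1 ⟨h1, hAD.trans hh.2⟩

theorem EndStep.next_cons (h : Packed p D.size) (hs : EndStep φ p D A) {X Y : Disk}
    (hXY : Next φ p X Y) : Next φ (D :: p) X Y :=
  hXY.cons fun hh => (hs.lt h hXY.1).not_gt hh.1

/-- The gap has width `2ab`, and `D` needs `2d(a+b)` of it. -/
theorem Tangent.fit (h : Tangent A B) (hφ : IsDirection φ) (hs : InsertStep φ p D A B) :
    D.size * (A.size + B.size) ≤ A.size * B.size := by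
  have := h.sub_eq hφ hs.1.2.2.1
  obtain ⟨h1, h2, h3, h4⟩ := hs
  nlinarith

/-- Here `b ≤ a`. If `A` and `B` touch, then `1/D.size ≥ 1/a + 1/b ≥ 2/a`; in a slack gap, `a ≥ 2b ≥
2 * D.size`. -/
theorem InsertStep.two_mul_le {d : ℝ} (h : Structured p d) (hle : D.size ≤ d)
    (hφ : IsDirection φ) (hs : InsertStep φ p D A B) : 2 * D.size ≤ A.size := by
  have hA := h.size_pos hs.1.1
  have hB := h.size_pos hs.1.2.1
  have hdB := hle.trans (h.le_size B hs.1.2.1)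
  have hBA := hs.2.1
  rcases h.gap φ hφ A B hs.1 with h1 | h1 | h1
  · have := h1.fit hφ hs
    by_contra! hc
    nlinarith
  · linarith [h1.1]
  · linarith [h1.1]

/-- As `D` touches `B`, only the new gap between `A` and `D` may be loose. It is slack with `B` in
the role of the older touching disk, `D` being at the head of the list. -/
theorem InsertStep.gap {d : ℝ} (h : Structured p d) (hle : D.size ≤ d) (hD : 0 < D.size)
    (hφ : IsDirection φ) (hs : InsertStep φ p D A B) {X Y : Disk} (hXY : Next φ (D :: p) X Y) :
    Gap φ (D :: p) D.size X Y := by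
  have hP := h.toPacked.mono hD hle
  have hA := h.size_pos hs.1.1
  have hB := h.size_pos hs.1.2.1
  have hDB : Tangent D B := tangent_of_sub_eq hφ hD hB hs.2.2.1
  rcases hs.next_cases hP hφ hXY with ⟨rfl, rfl⟩ | ⟨rfl, rfl⟩ | ⟨hX, hY, hXY, hXA, hYB⟩
  · refine .inr (.inl ⟨hs.two_mul_le h hle hφ, .inr ⟨B, hs.next_right hP, hDB,
      hP.le_size B hs.1.2.1, hs.2.1, ?_⟩⟩)
    exact List.Sublist.cons_cons _ (List.singleton_sublist.2 hs.1.2.1)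
  · exact .inl hDB
  · have hX' := h.size_pos hXY.1
    have hY' := h.size_pos hXY.2.1
    rcases h.gap φ hφ X Y hXY with h1 | h1 | h1
    · exact .inl h1
    · refine .inr (.inl (h1.weaken hle hX' hY' (fun C hC ht => ?_) fun C hC => h.size_pos hC))
      -- If `D` fills the very gap that compensates for the gap between `X` and `Y`, then
      -- `Tangent.fit` provides what `Slack.weaken` needs.
      by_cases hYA : Y = A
      · subst hYA
        obtain rfl := hC.unique_right hP hφ hs.1
        exact .inr (ht.fit hφ hs)
      · exact .inl (hs.next_cons hP hφ hC hYA)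
    · refine .inr (.inr (h1.weaken hle hY' hX' (fun C hC ht => ?_) fun C hC => h.size_pos hC))
      rw [next_neg_iff] at hC ⊢
      by_cases hCA : C = A
      · subst hCA
        obtain rfl := hC.unique_right hP hφ hs.1
        refine .inr ?_
        have := ht.symm.fit hφ hs
        linarith
      · exact .inl (hs.next_cons hP hφ hC hCA)

theorem EndStep.gap {d : ℝ} (h : Structured p d) (hle : D.size ≤ d) (hD : 0 < D.size)
    (hφ : IsDirection φ) (hs : EndStep φ p D A) {X Y : Disk} (hXY : Next φ (D :: p) X Y) :
    Gap φ (D :: p) D.size X Y := by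
  have hP := h.toPacked.mono hD hle
  have hA := h.size_pos hs.1.1
  rcases hs.next_cases hP hφ hXY with ⟨rfl, rfl⟩ | ⟨hX, hY, hXY⟩
  · exact .inl (tangent_of_sub_eq hφ hD hA hs.2)
  · have hX' := h.size_pos hXY.1
    have hY' := h.size_pos hXY.2.1
    rcases h.gap φ hφ X Y hXY with h1 | h1 | h1
    · exact .inl h1
    · exact .inr (.inl (h1.weaken hle hX' hY' (fun C hC ht => .inl (hs.next_cons hP hC))
        fun C hC => h.size_pos hC))
    · refine .inr (.inr (h1.weaken hle hY' hX' (fun C hC ht => .inl ?_) fun C hC => h.size_pos hC))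
      rw [next_neg_iff] at hC ⊢
      exact hs.next_cons hP hC

theorem gap_of_direction {d : ℝ} (hφ : IsDirection φ)
    (h : ∀ X Y, Next φ p X Y → Gap φ p d X Y) (ψ : Disk → ℝ) (hψ : IsDirection ψ) (X Y : Disk)
    (hXY : Next ψ p X Y) : Gap ψ p d X Y := by
  rcases hφ.eq_or_eq_neg hψ with rfl | rfl
  · exact h X Y hXY
  · exact (h Y X (next_neg_iff.1 hXY)).neg

theorem InsertStep.structured {d : ℝ} (h : Structured p d) (hle : D.size ≤ d) (hD : 0 < D.size)
    (hφ : IsDirection φ) (hs : InsertStep φ p D A B) : Structured (D :: p) D.size := by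
  have hP := h.toPacked.mono hD hle
  have hA := h.size_pos hs.1.1
  have hB := h.size_pos hs.1.2.1
  have hDB : Tangent D B := tangent_of_sub_eq hφ hD hB hs.2.2.1
  obtain ⟨hAD, hDB'⟩ := hs.lt hP
  have h2 := hs.two_mul_le h hle hφ
  refine ⟨hs.packed hP hφ, gap_of_direction hφ fun X Y hXY => hs.gap h hle hD hφ hXY, ?_⟩
  intro ψ hψ X Y hX hXY
  rcases hφ.eq_or_eq_neg hψ with rfl | rfl
  · rcases hs.next_cases hP hφ hXY with ⟨rfl, rfl⟩ | ⟨rfl, rfl⟩ | ⟨hXD, hYD, hXY', hXA, hYB⟩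
    · exact .inl h2
    · exact absurd (hX.2 A (by simp [hs.1.1])) hAD.not_ge
    · have hX' : First ψ p X := ⟨hXY'.1, fun E hE => hX.2 E (by simp [hE])⟩
      refine (h.first ψ hφ X Y hX' hXY').imp_right fun ⟨ht, hC⟩ => ⟨ht, fun C hYC => ?_⟩
      rcases hs.next_cases hP hφ hYC with ⟨rfl, rfl⟩ | ⟨rfl, rfl⟩ | ⟨_, _, hYC', _, _⟩
      · exact .inr (.inl h2)
      · exact absurd rfl hYD
      · exact hC C hYC'
  · have hXY1 := next_neg_iff.1 hXY
    rcases hs.next_cases hP hφ hXY1 with ⟨rfl, rfl⟩ | ⟨rfl, rfl⟩ | ⟨hYD, hXD, hXY', hYA, hXB⟩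
    · have := hX.2 B (by simp [hs.1.2.1])
      simp only [Pi.neg_apply, neg_le_neg_iff] at this
      exact absurd this hDB'.not_ge
    · have hX' : First (-φ) p X := ⟨hs.1.2.1, fun E hE => hX.2 E (by simp [hE])⟩
      refine .inr ⟨hDB.symm, fun C hC => ?_⟩
      rcases hs.next_cases hP hφ (next_neg_iff.1 hC) with ⟨rfl, _⟩ | ⟨rfl, rfl⟩ | ⟨_, hne, _⟩
      -- The new disk separates the end disk `X` from `C`. As `X` is the smaller of the two, they
      -- touched before, and `Tangent.fit` yields the last alternative.
      · rcases h.first _ hφ.neg X C hX' (next_neg_iff.2 hs.1) with h3 | ⟨h3, _⟩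
        · linarith [hs.2.1]
        · have := h3.symm.fit hφ hs
          exact .inr (.inr (by linarith))
      · exact absurd hDB' (lt_irrefl _)
      · exact absurd rfl hne
    · have hX' : First (-φ) p X := ⟨hXY'.2.1, fun E hE => hX.2 E (by simp [hE])⟩
      refine (h.first _ hψ X Y hX' (next_neg_iff.2 hXY')).imp_right
        fun ⟨ht, hC⟩ => ⟨ht, fun C hYC => ?_⟩
      rcases hs.next_cases hP hφ (next_neg_iff.1 hYC) with ⟨rfl, rfl⟩ | ⟨rfl, rfl⟩ |
        ⟨_, _, hYC', _, _⟩
      · exact absurd rfl hYD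
      · exact .inl hDB.symm
      · exact hC C (next_neg_iff.2 hYC')

theorem EndStep.structured {d : ℝ} (h : Structured p d) (hle : D.size ≤ d) (hD : 0 < D.size)
    (hφ : IsDirection φ) (hs : EndStep φ p D A) : Structured (D :: p) D.size := by
  have hP := h.toPacked.mono hD hle
  have hA := h.size_pos hs.1.1
  have hDA : Tangent D A := tangent_of_sub_eq hφ hD hA hs.2
  refine ⟨hs.packed hP hφ, gap_of_direction hφ fun X Y hXY => hs.gap h hle hD hφ hXY, ?_⟩
  intro ψ hψ X Y hX hXY
  rcases hφ.eq_or_eq_neg hψ with rfl | rfl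
  · rcases hs.next_cases hP hφ hXY with ⟨rfl, rfl⟩ | ⟨hXD, hYD, hXY'⟩
    · refine .inr ⟨hDA, fun C hC => ?_⟩
      rcases hs.next_cases hP hφ hC with ⟨rfl, rfl⟩ | ⟨_, _, hC'⟩
      · exact absurd hC.2.2.1 (lt_irrefl _)
      · exact (h.first ψ hφ Y C hs.1 hC').elim (fun h3 => .inr (.inl h3)) fun h3 => .inl h3.1
    · exact absurd (hX.2 D (by simp)) (hs.lt hP hXY'.1).not_ge
  · rcases hs.next_cases hP hφ (next_neg_iff.1 hXY) with ⟨rfl, rfl⟩ | ⟨hYD, hXD, hXY'⟩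
    · refine .inr ⟨hDA.symm, fun C hC => ?_⟩
      rcases hs.next_cases hP hφ (next_neg_iff.1 hC) with ⟨rfl, rfl⟩ | ⟨_, h', _⟩
      · exact absurd hC.2.2.1 (lt_irrefl _)
      · exact absurd rfl h'
    · have hX' : First (-φ) p X := ⟨hXY'.2.1, fun E hE => hX.2 E (by simp [hE])⟩
      refine (h.first _ hψ X Y hX' (next_neg_iff.2 hXY')).imp_right
        fun ⟨ht, hC⟩ => ⟨ht, fun C hYC => ?_⟩
      rcases hs.next_cases hP hφ (next_neg_iff.1 hYC) with ⟨rfl, rfl⟩ | ⟨_, _, hYC'⟩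
      · exact .inl hDA.symm
      · exact hC C (next_neg_iff.2 hYC')

end steps

/-! ### The gaps of a placement into which a disk of size `d` does not fit -/

/-- Let `s = a+b`. If `s ≥ 4d`, then `2ab ≤ 2ds` suffices. Otherwise `2ab ≤ s²/2`, and the claim
follows from `(4d-s)(s-4d/3) ≥ 0`. -/
theorem tangent_gap_le {a b d : ℝ} (hd : 0 < d) (ha : d ≤ a) (hb : d ≤ b)
    (h : a * b ≤ d * (a + b)) : 2 * a * b ≤ 8 / 3 * (d * (a + b) - d ^ 2) := by
  rcases le_or_gt (4 * d) (a + b) with hs | hs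
  · nlinarith
  · have h1 : 0 ≤ (4 * d - (a + b)) * ((a + b) - 4 / 3 * d) :=
      mul_nonneg (by linarith) (by linarith)
    nlinarith [sq_nonneg (a - b)]

theorem large_gap_le {a b d x : ℝ} (hd : 0 < d) (hs : 4 * d ≤ a + b) (h : x ≤ 2 * d * (a + b)) :
    x ≤ 8 / 3 * (d * (a + b) - d ^ 2) := by
  nlinarith

/-- The assumptions give `b < 4d/3`, so the surplus grows with `a` and with `c`. At `a = 2b`, `c =
b` it is `2(b-d)(8d/3-b) ≥ 0`. -/
theorem slack_gap_le {a b c d x y : ℝ} (hd : 0 < d) (hb : d ≤ b) (hbc : b ≤ c) (hab : 2 * b ≤ a)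
    (hs : a + b < 4 * d) (hx : x ≤ 2 * d * (a + b)) (hy : y = 2 * b * c) :
    x + y ≤ 8 / 3 * (d * (a + b) - d ^ 2) + 8 / 3 * (d * (b + c) - d ^ 2) := by
  have h1 : 0 ≤ (4 / 3 * d - b) * (c - b) := mul_nonneg (by linarith) (by linarith)
  have h2 : 0 ≤ (4 / 3 * d - b) * (b - d) := mul_nonneg (by linarith) (by linarith)
  nlinarith

/-- The claim is linear in `e`, with critical slope `2a-8d/3`. If `a ≤ 4d/3`, the worst case is `e =
d`. Otherwise it is the largest possible `e = ad/(a-d)`, which leaves `2a²-6ad+14d²/3 ≥ 0`, a form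
of negative discriminant. -/
theorem first_gap_le {a e d : ℝ} (hd : 0 < d) (ha : d ≤ a) (ha' : a < 3 / 2 * d) (he : d ≤ e)
    (h : a * e ≤ d * (a + e)) :
    2 * a * e + (2 * d ^ 2 - 4 / 3 * a * d) ≤ 8 / 3 * (d * (a + e) - d ^ 2) := by
  rcases le_or_gt a (4 / 3 * d) with h1 | h1
  · nlinarith [mul_nonneg (sub_nonneg.2 h1) (sub_nonneg.2 he)]
  · have had : 0 < a - d := by linarith
    have h2 : (a - d) * e ≤ a * d := by nlinarith
    have h3 : (2 * a - 8 / 3 * d) * ((a - d) * e) ≤ (2 * a - 8 / 3 * d) * (a * d) :=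
      mul_le_mul_of_nonneg_left h2 (by linarith)
    have h4 : 0 ≤ d * (2 * a ^ 2 - 6 * a * d + 14 / 3 * d ^ 2) := by
      apply mul_nonneg hd.le
      nlinarith [sq_nonneg (2 * a - 3 * d), sq_nonneg d]
    refine le_of_mul_le_mul_left ?_ had
    nlinarith

/-- The order of a placement list records the age of the disks: of two disks, only one can be the
newer one. -/
theorem not_sublist_swap {α : Type*} {a b : α} {l : List α} (hl : l.Nodup)
    (h : [a, b].Sublist l) : ¬ [b, a].Sublist l := by
  induction l with
  | nil => simp at h
  | cons x l ih =>
    intro h'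
    obtain ⟨hx, hl⟩ := List.nodup_cons.1 hl
    rcases List.sublist_cons_iff.1 h with h1 | ⟨r, h1, h2⟩
    · rcases List.sublist_cons_iff.1 h' with h3 | ⟨r', h3, h4⟩
      · exact ih hl h1 h3
      · obtain ⟨rfl, -⟩ := List.cons_eq_cons.1 h3
        exact hx (h1.subset (by simp))
    · obtain ⟨rfl, rfl⟩ := List.cons_eq_cons.1 h1
      rcases List.sublist_cons_iff.1 h' with h3 | ⟨r', h3, h4⟩
      · exact hx (h3.subset (by simp))
      · obtain ⟨rfl, rfl⟩ := List.cons_eq_cons.1 h3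
        exact hx (by simpa using h2)

/-! ### Covering the gaps by half-widths -/

/-- Four thirds of the half-width that a disk of size `a` takes among disks of size
at least `d`. -/
noncomputable def halfWidth (d : ℝ) (A : Disk) : ℝ := 4 / 3 * (2 * A.size * d - d ^ 2)

theorem halfWidth_add (d : ℝ) (A B : Disk) :
    halfWidth d A + halfWidth d B = 8 / 3 * (d * (A.size + B.size) - d ^ 2) := by
  unfold halfWidth; ring

/-- A gap that is too wide for the half-widths of its two disks. -/
def WideGap (φ : Disk → ℝ) (p : List Disk) (d : ℝ) (A B : Disk) : Prop :=
  Next φ p A B ∧ ¬ Tangent A B ∧ A.size + B.size < 4 * d ∧ 2 * B.size ≤ A.size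

/-- The bound is the room that a disk of size `d` takes when it touches both neighbours. -/
def TooSmall (φ : Disk → ℝ) (p : List Disk) (d : ℝ) : Prop :=
  ∀ A B, Next φ p A B → φ B - φ A ≤ 2 * d * (A.size + B.size)

theorem TooSmall.neg {φ : Disk → ℝ} {p : List Disk} {d : ℝ} (h : TooSmall φ p d) :
    TooSmall (-φ) p d := fun A B hAB => by
  have := h B A (next_neg_iff.1 hAB)
  simp only [Pi.neg_apply]
  linarith

section

variable {φ : Disk → ℝ} {p : List Disk} {d : ℝ} {A B C : Disk}

theorem WideGap.exists_next (h : Structured p d) (hφ : IsDirection φ) (hgap : TooSmall φ p d)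
    (hAB : WideGap φ p d A B) :
    ∃ C, Next φ p B C ∧ Tangent B C ∧ [B, C].Sublist p ∧
      φ C - φ A ≤ halfWidth d A + halfWidth d B + (halfWidth d B + halfWidth d C) := by
  obtain ⟨h1, h2, h3, h4⟩ := hAB
  have hA := h.size_pos h1.1
  have hB := h.size_pos h1.2.1
  rcases h.gap φ hφ A B h1 with h5 | h5 | h5
  · exact absurd h5 h2
  · rcases h5.2 with h6 | ⟨C, h6, h7, h8, h9, h10⟩
    -- Here `d(a+b) ≤ ab ≤ (a+b)²/4`, so `a+b ≥ 4d`, and the gap is not wide.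
    · nlinarith [sq_nonneg (A.size - B.size)]
    · refine ⟨C, h6, h7, h10, ?_⟩
      have := slack_gap_le h.pos (h.le_size B h1.2.1) h8 h4 h3 (hgap A B h1)
        (h7.sub_eq hφ h6.2.2.1)
      rw [halfWidth_add, halfWidth_add]
      linarith
  · linarith [h5.1]

theorem WideGap.next_not_wide (h : Structured p d) (hφ : IsDirection φ) (hgap : TooSmall φ p d)
    (hAB : WideGap φ p d A B) (hBC : Next φ p B C) : Tangent B C := by
  obtain ⟨C', h1, h2, -⟩ := hAB.exists_next h hφ hgap
  obtain rfl := h1.unique_right h.toPacked hφ hBC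
  exact h2

theorem sub_le_of_not_wide (h : Structured p d) (hφ : IsDirection φ) (hgap : TooSmall φ p d)
    (hAB : Next φ p A B) (h1 : ¬ WideGap φ p d A B) (h2 : ¬ WideGap (-φ) p d B A) :
    φ B - φ A ≤ halfWidth d A + halfWidth d B := by
  rw [halfWidth_add]
  have hx := hgap A B hAB
  by_cases ht : Tangent A B
  · have he := ht.sub_eq hφ hAB.2.2.1
    rw [he]
    exact tangent_gap_le h.pos (h.le_size A hAB.1) (h.le_size B hAB.2.1) (by nlinarith)
  · rcases le_or_gt (4 * d) (A.size + B.size) with hs | hs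
    · exact large_gap_le h.pos hs hx
    · rcases h.gap φ hφ A B hAB with h3 | h3 | h3
      · exact absurd h3 ht
      · exact absurd ⟨hAB, ht, hs, h3.1⟩ h1
      · exact absurd ⟨next_neg_iff.2 hAB, fun h => ht h.symm, by linarith, h3.1⟩ h2

/-- Moving the smaller disk of each wide gap makes all gaps fit the half-widths. -/
theorem exists_adjusted (h : Structured p d) (hφ : IsDirection φ) (hgap : TooSmall φ p d) :
    ∃ g : Disk → ℝ, (∀ A B, Next φ p A B → g B - g A ≤ halfWidth d A + halfWidth d B) ∧
      ∀ B, (∀ A, ¬ WideGap φ p d A B) → (∀ C, ¬ WideGap (-φ) p d C B) → g B = φ B := by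
  -- The smaller disk `B` of a wide gap moves to where this gap is exactly the sum of the two
  -- half-widths. It has no second wide gap asking for another position, since the gap on its other
  -- side is tangent.
  have key : ∀ B, ∃ y : ℝ,
      (∀ A, WideGap φ p d A B → y = φ A + halfWidth d A + halfWidth d B) ∧
      (∀ C, WideGap (-φ) p d C B → y = φ C - halfWidth d C - halfWidth d B) ∧
      ((∀ A, ¬ WideGap φ p d A B) → (∀ C, ¬ WideGap (-φ) p d C B) → y = φ B) := by
    intro B
    by_cases h1 : ∃ A, WideGap φ p d A B
    · obtain ⟨A, hA⟩ := h1
      refine ⟨φ A + halfWidth d A + halfWidth d B, fun A' hA' => ?_, fun C hC => ?_,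
        fun h' _ => absurd hA (h' A)⟩
      · rw [hA.1.unique_left h.toPacked hφ hA'.1]
      · exact absurd (hA.next_not_wide h hφ hgap (next_neg_iff.1 hC.1)).symm hC.2.1
    · push Not at h1
      by_cases h2 : ∃ C, WideGap (-φ) p d C B
      · obtain ⟨C, hC⟩ := h2
        refine ⟨φ C - halfWidth d C - halfWidth d B, fun A hA => absurd hA (h1 A),
          fun C' hC' => ?_, fun _ h' => absurd hC (h' C)⟩
        rw [hC.1.unique_left h.toPacked hφ.neg hC'.1]
      · push Not at h2
        exact ⟨φ B, fun A hA => absurd hA (h1 A), fun C hC => absurd hC (h2 C), fun _ _ => rfl⟩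
  choose g hg1 hg2 hg3 using key
  refine ⟨g, fun B C hBC => ?_, hg3⟩
  have hBC' := next_neg_iff (φ := φ).2 hBC
  by_cases hw : WideGap φ p d B C
  -- The larger disk of a wide gap does not move.
  · have hB : g B = φ B := by
      refine hg3 B (fun A hA => hw.2.1 (hA.next_not_wide h hφ hgap hBC)) fun E hE => ?_
      obtain rfl := (next_neg_iff.1 hE.1).unique_right h.toPacked hφ hBC
      have := hE.2.2.2
      have := hw.2.2.2
      linarith [h.size_pos hBC.1]
    rw [hg1 C B hw, hB]
    linarith
  by_cases hw' : WideGap (-φ) p d C B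
  · have hC : g C = φ C := by
      refine hg3 C (fun A hA => ?_) fun E hE => ?_
      · obtain rfl := hA.1.unique_left h.toPacked hφ hBC
        exact hw hA
      · exact hw'.2.1 (hE.next_not_wide h hφ.neg hgap.neg hBC')
    rw [hg2 B C hw', hC]
    linarith
  have hB2 : ∀ E, ¬ WideGap (-φ) p d E B := fun E hE => by
    obtain rfl := (next_neg_iff.1 hE.1).unique_right h.toPacked hφ hBC
    exact hw' hE
  have hC1 : ∀ E, ¬ WideGap φ p d E C := fun E hE => by
    obtain rfl := hE.1.unique_left h.toPacked hφ hBC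
    exact hw hE
  by_cases hA : ∃ A, WideGap φ p d A B
  · obtain ⟨A, hA⟩ := hA
    obtain ⟨C', h1, h2, h3, h4⟩ := hA.exists_next h hφ hgap
    obtain rfl := h1.unique_right h.toPacked hφ hBC
    -- If `C'` moved as well, `B` and `C'` would each be newer than the other.
    have hC : g C' = φ C' := by
      refine hg3 C' hC1 fun E hE => ?_
      obtain ⟨B', h5, h6, h7, h8⟩ := hE.exists_next h hφ.neg hgap.neg
      obtain rfl := h5.unique_right h.toPacked hφ.neg hBC'
      exact not_sublist_swap h.nodup h3 h7
    rw [hC, hg1 B A hA]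
    linarith
  · push Not at hA
    rw [hg3 B hA hB2]
    by_cases hE : ∃ E, WideGap (-φ) p d E C
    · obtain ⟨E, hE⟩ := hE
      obtain ⟨B', h1, h2, h3, h4⟩ := hE.exists_next h hφ.neg hgap.neg
      obtain rfl := h1.unique_right h.toPacked hφ.neg hBC'
      rw [hg2 C E hE]
      simp only [Pi.neg_apply] at h4
      linarith
    · push Not at hE
      rw [hg3 C hC1 hE]
      exact sub_le_of_not_wide h hφ hgap hBC hw hw'

/-- Telescoping the adjusted positions. The end disks keep theirs, because the smaller disk of a
wide gap has neighbours on both sides. The second part exhibits the room left in the first gap next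
to a small end disk. -/
theorem sub_le_sum (h : Structured p d) (hφ : IsDirection φ) (hgap : TooSmall φ p d) {Z : Disk}
    (hA : First φ p A) (hZ : First (-φ) p Z) :
    φ Z - φ A ≤ 2 * (p.map (halfWidth d)).sum - halfWidth d A - halfWidth d Z ∧
    (A ≠ Z → A.size < 3 / 2 * d → φ Z - φ A + (2 * d ^ 2 - 4 / 3 * A.size * d) ≤
      2 * (p.map (halfWidth d)).sum - halfWidth d A - halfWidth d Z) := by
  obtain ⟨g, hg, hg'⟩ := exists_adjusted h hφ hgap
  have hnoA : ∀ E, ¬ Next φ p E A := fun E hE => hE.2.2.1.not_ge (hA.2 E hE.1)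
  have hnoZ : ∀ E, ¬ Next φ p Z E := fun E hE => by
    have := hZ.2 E hE.2.1
    simp only [Pi.neg_apply, neg_le_neg_iff] at this
    exact hE.2.2.1.not_ge this
  have hgA : g A = φ A := by
    refine hg' A (fun E hE => hnoA E hE.1) fun E hE => ?_
    obtain ⟨X, hX, -⟩ := hE.exists_next h hφ.neg hgap.neg
    exact hnoA X (next_neg_iff.1 hX)
  have hgZ : g Z = φ Z := by
    refine hg' Z (fun E hE => ?_) fun E hE => hnoZ E (next_neg_iff.1 hE.1)
    obtain ⟨X, hX, -⟩ := hE.exists_next h hφ hgap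
    exact hnoZ X hX
  constructor
  · have := sub_le_of_next_le _ p rfl (h.ne hφ) hg A Z hA hZ
    rwa [hgA, hgZ] at this
  · intro hAZ ha
    have hfirst : ∀ E, Next φ p A E →
        φ E - φ A + (2 * d ^ 2 - 4 / 3 * A.size * d) ≤ halfWidth d A + halfWidth d E ∧
        g E = φ E := by
      intro E hE
      have hdE := h.le_size E hE.2.1
      have hdA := h.le_size A hA.1
      have hd := h.pos
      rcases h.first φ hφ A E hA hE with h1 | ⟨h1, h2⟩
      · linarith
      · have he := h1.sub_eq hφ hE.2.2.1
        have hx := hgap A E hE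
        refine ⟨?_, hg' E (fun X hX => ?_) fun C hC => ?_⟩
        · rw [halfWidth_add, he]
          exact first_gap_le hd hdA ha hdE (by nlinarith)
        · obtain rfl := hX.1.unique_left h.toPacked hφ hE
          exact hX.2.1 h1
        · have hEC := next_neg_iff.1 hC.1
          have h4 := hC.2.2.1
          have h5 := hC.2.2.2
          rcases h2 C hEC with h3 | h3 | h3
          · exact hC.2.1 h3.symm
          · linarith
          · have hdC := h.le_size C hEC.2.1
            -- With `a < 3d/2` this needs `c > 3d`, whereas a wide gap between `C` and `E` has `c <
            -- 4d - e ≤ 3d`.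
            have h6 : d * (A.size + C.size) ≤ A.size * C.size :=
              (mul_le_mul_of_nonneg_right hdE (by linarith)).trans h3
            have h7 : C.size < 3 * d := by linarith
            nlinarith [mul_pos hd hd, mul_nonneg (sub_nonneg.2 hdA) (sub_nonneg.2 h7.le)]
    classical
    -- Moving `A` outwards by the room to spare keeps all gaps within their half-widths.
    have := sub_le_of_next_le (h := halfWidth d) (g := Function.update g A (φ A - (2 * d ^ 2 - 4 / 3 * A.size * d)))
      _ p rfl (h.ne hφ) (fun X Y hXY => by
        have hY : Y ≠ A := by rintro rfl; exact hnoA X hXY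
        rw [Function.update_of_ne hY]
        by_cases hX : X = A
        · rw [hX] at hXY ⊢
          rw [Function.update_self, (hfirst Y hXY).2]
          linarith [(hfirst Y hXY).1]
        · rw [Function.update_of_ne hX]
          exact hg X Y hXY) A Z hA hZ
    rw [Function.update_self, Function.update_of_ne hAZ.symm, hgZ] at this
    linarith

end

/-! ### The steps of the greedy algorithm -/

theorem fitsBetween_iff {d : ℝ} {A B : Disk} (hd : 0 < d) (hA : 0 < A.size) (hB : 0 < B.size) :
    FitsBetween d A B ↔ 2 * d * (A.size + B.size) ≤ B.foot - A.foot := by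
  constructor
  · rintro ⟨D, rfl, h1, h2, h3, h4⟩
    rw [Disk.nonOverlapping_iff hd hA, abs_of_pos (sub_pos.2 h1)] at h3
    rw [Disk.nonOverlapping_iff hd hB, abs_sub_comm, abs_of_pos (sub_pos.2 h2)] at h4
    linarith
  · intro h
    have h1 := mul_pos hd hA
    have h2 := mul_pos hd hB
    have h3 : A.foot < A.foot + 2 * d * A.size := by linarith
    have h4 : A.foot + 2 * d * A.size < B.foot := by linarith
    refine ⟨⟨d, A.foot + 2 * d * A.size⟩, rfl, h3, h4, ?_, ?_⟩
    · rw [Disk.nonOverlapping_iff hd hA, abs_of_pos (sub_pos.2 h3)]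
      simp
    · rw [Disk.nonOverlapping_iff hd hB, abs_sub_comm, abs_of_pos (sub_pos.2 h4)]
      simp only
      linarith

theorem isLeftCandidate_iff {d : ℝ} {A L : Disk} (hd : 0 < d) (hA : 0 < A.size) :
    IsLeftCandidate d A L ↔ L.size = d ∧ A.foot - L.foot = 2 * d * A.size := by
  have := mul_pos hd hA
  constructor
  · rintro ⟨rfl, h1, h2⟩
    rw [Disk.touches_iff hd hA, abs_sub_comm, abs_of_pos (sub_pos.2 h1)] at h2
    exact ⟨rfl, h2⟩
  · rintro ⟨rfl, h⟩
    have h1 : L.foot < A.foot := by nlinarith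
    refine ⟨rfl, h1, ?_⟩
    rw [Disk.touches_iff hd hA, abs_sub_comm, abs_of_pos (sub_pos.2 h1), h]

theorem isRightCandidate_iff {d : ℝ} {Z R : Disk} (hd : 0 < d) (hZ : 0 < Z.size) :
    IsRightCandidate d Z R ↔ R.size = d ∧ R.foot - Z.foot = 2 * d * Z.size := by
  have := mul_pos hd hZ
  constructor
  · rintro ⟨rfl, h1, h2⟩
    rw [Disk.touches_iff hd hZ, abs_of_pos (sub_pos.2 h1)] at h2
    exact ⟨rfl, h2⟩
  · rintro ⟨rfl, h⟩
    have h1 : Z.foot < R.foot := by nlinarith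
    refine ⟨rfl, h1, ?_⟩
    rw [Disk.touches_iff hd hZ, abs_of_pos (sub_pos.2 h1), h]

theorem endStep_left {p : List Disk} {A D : Disk} (hD : 0 < D.size) (hA : IsLeftmost p A)
    (hA' : 0 < A.size) (h : IsLeftCandidate D.size A D) : EndStep Disk.foot p D A :=
  ⟨first_foot_iff.2 hA, ((isLeftCandidate_iff hD hA').1 h).2⟩

theorem endStep_right {p : List Disk} {Z D : Disk} (hD : 0 < D.size) (hZ : IsRightmost p Z)
    (hZ' : 0 < Z.size) (h : IsRightCandidate D.size Z D) : EndStep (-Disk.foot) p D Z := by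
  refine ⟨first_neg_foot_iff.2 hZ, ?_⟩
  have := ((isRightCandidate_iff hD hZ').1 h).2
  simp only [Pi.neg_apply]
  linarith

theorem insertStep_left {p : List Disk} {A B D : Disk} (hD : 0 < D.size)
    (hA : 0 < A.size) (hB : 0 < B.size) (hAB : Consecutive p A B)
    (hfit : FitsBetween D.size A B) (hl : A.foot < D.foot) (hle : A.size ≤ B.size)
    (ht : D.Touches A) : InsertStep (-Disk.foot) p D B A := by
  rw [fitsBetween_iff hD hA hB] at hfit
  rw [Disk.touches_iff hD hA, abs_of_pos (sub_pos.2 hl)] at ht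
  refine ⟨next_neg_iff.2 hAB, hle, ?_, ?_⟩ <;> simp only [Pi.neg_apply] <;> linarith

theorem insertStep_right {p : List Disk} {A B D : Disk} (hD : 0 < D.size)
    (hA : 0 < A.size) (hB : 0 < B.size) (hAB : Consecutive p A B)
    (hfit : FitsBetween D.size A B) (hr : D.foot < B.foot) (hle : B.size ≤ A.size)
    (ht : D.Touches B) : InsertStep Disk.foot p D A B := by
  rw [fitsBetween_iff hD hA hB] at hfit
  rw [Disk.touches_iff hD hB, abs_sub_comm, abs_of_pos (sub_pos.2 hr)] at ht
  refine ⟨hAB, hle, ?_, ?_⟩ <;> linarith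

/-- The footpoint of `D` lies between those of its neighbours, whose radii are at least as large, so
`D` protrudes beyond neither of them. -/
theorem InsertStep.extent {φ : Disk → ℝ} {p : List Disk} {A B D : Disk} {l r : ℝ}
    (h : Packed p D.size) (hφ : IsDirection φ) (hs : InsertStep φ p D A B) (hlr : Extent p l r) :
    Extent (D :: p) l r := by
  obtain ⟨h1, h2, h3, h4⟩ := hs
  have hA := h.le_size A h1.1
  have hB := h.le_size B h1.2.1
  have hd := h.pos
  have hA1 := hlr.right_le A h1.1
  have hA2 := hlr.le_left A h1.1
  have hB1 := hlr.right_le B h1.2.1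
  have hB2 := hlr.le_left B h1.2.1
  have hD : D.rightmostPoint ≤ r ∧ l ≤ D.leftmostPoint := by
    unfold Disk.leftmostPoint Disk.rightmostPoint Disk.radius at *
    rcases hφ with rfl | rfl
    · constructor <;> nlinarith
    · simp only [Pi.neg_apply] at h3 h4
      constructor <;> nlinarith
  have := hlr.cons D
  rwa [max_eq_left hD.1, min_eq_left hD.2] at this

theorem InsertStep.span_le {φ : Disk → ℝ} {p : List Disk} {A B D : Disk}
    (h : Packed p D.size) (hφ : IsDirection φ) (hs : InsertStep φ p D A B) :
    span (D :: p) ≤ span p := by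
  obtain ⟨l, r, hlr⟩ := exists_extent (List.ne_nil_of_mem hs.1.1)
  rw [hlr.span_eq, (hs.extent h hφ hlr).span_eq]

/-- Reduces the rules to two kinds of steps, up to reflection. In a growing step both ends are
allowed, as the span bound does not depend on the choice. -/
theorem GreedyStep.cases {p : List Disk} {D : Disk} (h : GreedyStep p D) (hp : p ≠ [])
    (hP : Packed p D.size) :
    (∃ φ A B, IsDirection φ ∧ InsertStep φ p D A B) ∨
    (∃ φ A, IsDirection φ ∧ EndStep φ p D A ∧ (span (D :: p) ≤ span p ∨ NoGap p D.size ∧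
      ∃ A Z L R, IsLeftmost p A ∧ IsRightmost p Z ∧ IsLeftCandidate D.size A L ∧
        IsRightCandidate D.size Z R ∧ span p < span (L :: p) ∧ span p < span (R :: p) ∧
        (D = L ∨ D = R))) := by
  have hD := hP.pos
  rcases h with hp' | ⟨A, B, hAB, hfit, hl, hr, ht⟩ | ⟨A, Z, hgap, hA, hZ, hD', hspan⟩ |
    ⟨A, Z, L, R, hgap, hA, hZ, hL, hR, hsL, hsR, hD'⟩
  · exact absurd hp' hp
  · left
    have hA := hP.size_pos hAB.1
    have hB := hP.size_pos hAB.2.1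
    rcases ht with ⟨hle, ht⟩ | ⟨hle, ht⟩
    · exact ⟨_, _, _, isDirection_foot.neg, insertStep_left hD hA hB hAB hfit hl hle ht⟩
    · exact ⟨_, _, _, isDirection_foot, insertStep_right hD hA hB hAB hfit hr hle ht⟩
  · right
    rcases hD' with h | h
    · exact ⟨_, _, isDirection_foot, endStep_left hD hA (hP.size_pos hA.1) h, .inl hspan⟩
    · exact ⟨_, _, isDirection_foot.neg, endStep_right hD hZ (hP.size_pos hZ.1) h, .inl hspan⟩
  · right
    rcases hD' with ⟨-, rfl⟩ | ⟨-, rfl⟩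
    · exact ⟨_, _, isDirection_foot, endStep_left hD hA (hP.size_pos hA.1) hL,
        .inr ⟨hgap, A, Z, D, R, hA, hZ, hL, hR, hsL, hsR, .inl rfl⟩⟩
    · exact ⟨_, _, isDirection_foot.neg, endStep_right hD hZ (hP.size_pos hZ.1) hR,
        .inr ⟨hgap, A, Z, L, D, hA, hZ, hL, hR, hsL, hsR, .inr rfl⟩⟩

theorem structured_singleton {D : Disk} (hD : 0 < D.size) : Structured [D] D.size := by
  have hno : ∀ φ A B, ¬ Next φ [D] A B := by
    rintro φ A B ⟨h1, h2, h3, -⟩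
    rw [List.mem_singleton] at h1 h2
    subst h1 h2
    exact lt_irrefl _ h3
  exact ⟨⟨hD, by simp, by simp⟩, fun φ _ A B h => absurd h (hno φ A B),
    fun φ _ A B _ h => absurd h (hno φ A B)⟩

theorem GreedyStep.structured {p : List Disk} {D : Disk} {d : ℝ} (h : GreedyStep p D)
    (hp : p ≠ []) (hP : Structured p d) (hle : D.size ≤ d) (hD : 0 < D.size) :
    Structured (D :: p) D.size := by
  rcases h.cases hp (hP.toPacked.mono hD hle) with ⟨φ, A, B, hφ, hs⟩ | ⟨φ, A, hφ, hs, -⟩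
  · exact hs.structured hP hle hD hφ
  · exact hs.structured hP hle hD hφ

/-- The span after a step in which both end candidates increase the span. -/
theorem span_cons_le {p : List Disk} {d : ℝ} {A Z L R D : Disk} (h : Structured p d)
    (hgap : NoGap p d) (hA : IsLeftmost p A) (hZ : IsRightmost p Z)
    (hL : IsLeftCandidate d A L) (hR : IsRightCandidate d Z R)
    (hsL : span p < span (L :: p)) (hsR : span p < span (R :: p)) (hD : D = L ∨ D = R) :
    span (D :: p) ≤ 2 * ((D :: p).map (halfWidth d)).sum := by
  have hd := h.pos
  have hA' := h.size_pos hA.1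
  have hZ' := h.size_pos hZ.1
  have hdA := h.le_size A hA.1
  have hdZ := h.le_size Z hZ.1
  obtain ⟨rfl, hL⟩ := (isLeftCandidate_iff hd hA').1 hL
  obtain ⟨hRs, hR⟩ := (isRightCandidate_iff hd hZ').1 hR
  obtain ⟨l, r, hlr⟩ := exists_extent (List.ne_nil_of_mem hA.1)
  have hAr := hlr.right_le A hA.1
  have hZl := hlr.le_left Z hZ.1
  have hAl := hlr.le_left A hA.1
  have hZr := hlr.right_le Z hZ.1
  have hLr : L.rightmostPoint ≤ r := by
    unfold Disk.rightmostPoint Disk.radius at *; nlinarith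
  have hRl : l ≤ R.leftmostPoint := by
    unfold Disk.leftmostPoint Disk.radius at *; rw [hRs]; nlinarith
  rw [hlr.span_eq, hlr.span_cons, max_eq_left hLr] at hsL
  rw [hlr.span_eq, hlr.span_cons, min_eq_left hRl] at hsR
  have hLl : L.leftmostPoint < l := by
    by_contra! hc
    rw [min_eq_left hc] at hsL
    exact lt_irrefl _ hsL
  have hRr : r < R.rightmostPoint := by
    by_contra! hc
    rw [max_eq_left hc] at hsR
    exact lt_irrefl _ hsR
  have hsmall : TooSmall Disk.foot p L.size := fun X Y hXY => by
    have := hgap X Y hXY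
    rw [fitsBetween_iff hd (h.size_pos hXY.1) (h.size_pos hXY.2.1)] at this
    exact (not_le.1 this).le
  have hsum := sub_le_sum h isDirection_foot hsmall (first_foot_iff.2 hA)
    (first_neg_foot_iff.2 hZ)
  have hsum' := sub_le_sum h isDirection_foot.neg hsmall.neg (first_neg_foot_iff.2 hZ)
    (by rw [neg_neg]; exact first_foot_iff.2 hA)
  simp only [Pi.neg_apply] at hsum'
  have hDsize : D.size = L.size := by rcases hD with rfl | rfl <;> simp [*]
  have hDw : halfWidth L.size D = 4 / 3 * L.size ^ 2 := by
    unfold halfWidth; rw [hDsize]; ring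
  rw [List.map_cons, List.sum_cons, hDw]
  -- A lone small disk has no gap with room to spare, but then the claim is `(a+d)² ≤ 16ad/3`, which
  -- holds for `d ≤ a ≤ 3d`.
  by_cases hAZ : A = Z ∧ A.size < 3 / 2 * L.size
  · obtain ⟨rfl, ha⟩ := hAZ
    have honly : ∀ E ∈ p, E = A := fun E hE =>
      h.toPacked.inj isDirection_foot hE hA.1 (le_antisymm (hZ.2 E hE) (hA.2 E hE))
    have hl : A.leftmostPoint = l := by
      obtain ⟨E, hE, e⟩ := hlr.exists_left
      rw [← e, honly E hE]
    have hr : A.rightmostPoint = r := by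
      obtain ⟨E, hE, e⟩ := hlr.exists_right
      rw [← e, honly E hE]
    have hspan : span (D :: p) = (A.size + L.size) ^ 2 := by
      rcases hD with rfl | rfl
      · rw [hlr.span_cons, max_eq_left hLr, min_eq_right hLl.le, ← hr]
        unfold Disk.leftmostPoint Disk.rightmostPoint Disk.radius
        linarith
      · rw [hlr.span_cons, max_eq_right hRr.le, min_eq_left hRl, ← hl]
        unfold Disk.leftmostPoint Disk.rightmostPoint Disk.radius
        rw [hRs]
        linarith
    rw [hspan]
    have := hsum.1
    unfold halfWidth at this ⊢
    nlinarith [mul_nonneg (sub_nonneg.2 hdA) (sub_nonneg.2 ha.le)]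
  -- The candidate at the end that was not chosen protrudes beyond the old disks, which bounds the
  -- extreme point there.
  · have hspan : span (D :: p) ≤ Z.foot - A.foot + 2 * L.size * (A.size + Z.size)
        + 2 * L.size ^ 2 := by
      rcases hD with rfl | rfl
      · rw [hlr.span_cons, max_eq_left hLr, min_eq_right hLl.le]
        unfold Disk.leftmostPoint Disk.rightmostPoint Disk.radius at *
        rw [hRs] at hRr
        linarith
      · rw [hlr.span_cons, max_eq_right hRr.le, min_eq_left hRl]
        unfold Disk.leftmostPoint Disk.rightmostPoint Disk.radius at *
        rw [hRs]
        linarith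
    have hAZw := halfWidth_add L.size A Z
    -- The half-widths of `A`, `Z` and `D` fall short by `2d² - 2/3 * d(a+z)`. This is nonpositive
    -- if `a+z ≥ 3d`; otherwise it is at most `2d² - 4/3 * d * min a z`, the room to spare next to
    -- the smaller end disk.
    rcases le_or_gt (3 * L.size) (A.size + Z.size) with hs | hs
    · nlinarith [hsum.1, mul_nonneg hd.le (sub_nonneg.2 hs)]
    · rcases le_total A.size Z.size with hle | hle
      · have ha : A.size < 3 / 2 * L.size := by linarith
        have := hsum.2 (fun e => hAZ ⟨e, ha⟩) ha
        nlinarith [mul_nonneg hd.le (sub_nonneg.2 hle)]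
      · have hz : Z.size < 3 / 2 * L.size := by linarith
        have := hsum'.2 (fun e => hAZ ⟨e.symm, e ▸ hz⟩) hz
        nlinarith [mul_nonneg hd.le (sub_nonneg.2 hle)]

/-! ### The approximation factor -/

theorem IsPlacement.packed {S : List ℝ} {q : List Disk} {d : ℝ} (hq : IsPlacement S q)
    (hd : 0 < d) (hS : ∀ s ∈ S, d ≤ s) : Packed q d :=
  packed_of_pairwise hd (fun _ hD => hS _ (hq.1.mem_iff.1 (List.mem_map_of_mem hD))) hq.2

theorem IsPlacement.ne_nil {S : List ℝ} {q : List Disk} (hq : IsPlacement S q) (hS : S ≠ []) :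
    q ≠ [] := by
  rintro rfl
  exact hS hq.1.nil_eq.symm

theorem Packed.isPlacement {p : List Disk} {d : ℝ} (h : Packed p d) :
    IsPlacement (p.map Disk.size) p := ⟨.refl _, h.pairwise⟩

/-- Removing a disk from a placement does not increase the span. -/
theorem IsPlacement.exists_tail {s : ℝ} {S : List ℝ} {q : List Disk}
    (hq : IsPlacement (s :: S) q) (hS : S ≠ []) :
    ∃ q', IsPlacement S q' ∧ span q' ≤ span q := by
  obtain ⟨E, hE, rfl⟩ := List.mem_map.1 (hq.1.mem_iff.2 List.mem_cons_self)
  obtain ⟨u, v, rfl⟩ := List.append_of_mem hE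
  have hperm : (u ++ E :: v).Perm (E :: (u ++ v)) := List.perm_middle
  have hq' : IsPlacement S (u ++ v) := by
    refine ⟨?_, ?_⟩
    · have := (hperm.map Disk.size).symm.trans hq.1
      rw [List.map_cons] at this
      exact (List.perm_cons _).1 this
    · exact hq.2.sublist (List.sublist_append_right [E] v |>.append_left u)
  refine ⟨u ++ v, hq', ?_⟩
  rw [span_perm hperm]
  exact span_le_span_cons (hq'.ne_nil hS) E

/-- The sum of the half-widths depends only on the sizes, so the lower bound for the span of `q`
applies to it. -/
theorem IsPlacement.sum_halfWidth_le {p q : List Disk} {d : ℝ}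
    (hq : IsPlacement (p.map Disk.size) q) (hd : 0 < d) (hp : ∀ D ∈ p, d ≤ D.size)
    (hne : p ≠ []) : 2 * (p.map (halfWidth d)).sum ≤ 4 / 3 * span q := by
  have h1 := (hq.packed hd (by simpa using hp)).sum_le_span (hq.ne_nil (by simpa using hne))
  have h2 : (p.map (halfWidth d)).sum = 4 / 3 * (q.map fun A => 2 * A.size * d - d ^ 2).sum := by
    have h3 := (hq.1.map fun s => 2 * s * d - d ^ 2).sum_eq
    simp only [List.map_map] at h3
    rw [← List.sum_map_mul_left]
    have h4 : (p.map (halfWidth d)).sum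
        = 4 / 3 * (p.map ((fun s => 2 * s * d - d ^ 2) ∘ Disk.size)).sum := by
      rw [← List.sum_map_mul_left]; rfl
    rw [h4, ← h3, List.sum_map_mul_left]
    rfl
  linarith

theorem span_singleton (D : Disk) : span [D] = 2 * D.size ^ 2 := by
  rw [span_eq (l := D.leftmostPoint) (r := D.rightmostPoint) (by simp) (by simp) (by simp)
    (by simp)]
  unfold Disk.leftmostPoint Disk.rightmostPoint Disk.radius
  ring

def SpanBound (p : List Disk) : Prop :=
  ∀ q, IsPlacement (p.map Disk.size) q → span p ≤ 4 / 3 * span q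

theorem spanBound_singleton {D : Disk} (hD : 0 < D.size) : SpanBound [D] := fun q hq => by
  have := hq.sum_halfWidth_le hD (by simp) (by simp)
  rw [span_singleton]
  simp only [List.map_cons, List.map_nil, List.sum_cons, List.sum_nil, halfWidth] at this
  nlinarith [sq_nonneg D.size]

theorem GreedyStep.spanBound {p : List Disk} {D : Disk} {d : ℝ} (h : GreedyStep p D)
    (hp : p ≠ []) (hP : Structured p d) (hle : D.size ≤ d) (hD : 0 < D.size)
    (hb : SpanBound p) : SpanBound (D :: p) := by
  have hP' := hP.mono hD hle
  -- Removing a disk of the size of `D` from a competitor gives a competitor of `p`.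
  have hmono : span (D :: p) ≤ span p → SpanBound (D :: p) := fun hs q hq => by
    obtain ⟨q', h1, h2⟩ := hq.exists_tail (by simpa using hp)
    linarith [hb q' h1]
  rcases h.cases hp hP'.toPacked with ⟨φ, A, B, hφ, hs⟩ | ⟨φ, A, hφ, hs, hs' | ⟨hgap, A, Z, L, R,
    hA, hZ, hL, hR, hsL, hsR, hDLR⟩⟩
  · exact hmono (hs.span_le hP'.toPacked hφ)
  · exact hmono hs'
  · intro q hq
    refine (span_cons_le hP' hgap hA hZ hL hR hsL hsR hDLR).trans ?_
    exact hq.sum_halfWidth_le hD (by simpa using hP'.le_size) (by simp)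

theorem GreedyFrom.isApproximation {p q : List Disk} {T : List ℝ} (h : GreedyFrom p T q) :
    ∀ d, Structured p d → SpanBound p → (∀ s ∈ T, 0 < s ∧ s ≤ d) → T.Pairwise (· ≥ ·) →
      p ≠ [] → IsApproximation (4 / 3) (p.map Disk.size ++ T) q := by
  induction h with
  | done p =>
    intro d hP hb _ _ _
    rw [List.append_nil]
    exact ⟨hP.toPacked.isPlacement, hb⟩
  | @place p q T D hD _ ih =>
    intro d hP hb hT hT' hp
    obtain ⟨h1, h2⟩ := hT D.size (by simp)
    obtain ⟨h3, h4⟩ := List.pairwise_cons.1 hT'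
    have := ih D.size (hD.structured hp hP h2 h1) (hD.spanBound hp hP h2 h1 hb)
      (fun s hs => ⟨(hT s (by simp [hs])).1, h3 s hs⟩) h4 (by simp)
    have hperm : (D.size :: (p.map Disk.size ++ T)).Perm (p.map Disk.size ++ D.size :: T) :=
      List.perm_middle.symm
    exact ⟨⟨this.1.1.trans hperm, this.1.2⟩, fun q' hq' =>
      this.2 q' ⟨hq'.1.trans hperm.symm, hq'.2⟩⟩

theorem GreedyOutput.isApproximation {S : List ℝ} {p : List Disk} (h : GreedyOutput S p)
    (hne : S ≠ []) (hS : ∀ s ∈ S, 0 < s) : IsApproximation (4 / 3) S p := by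
  obtain ⟨T, hTS, hT, hG⟩ := h
  cases hG with
  | done => exact absurd hTS.nil_eq.symm hne
  | place D hD hG =>
    rename_i T
    have hpos : ∀ s ∈ D.size :: T, 0 < s := fun s hs => hS s (hTS.mem_iff.1 hs)
    have hD0 := hpos D.size (by simp)
    obtain ⟨h3, h4⟩ := List.pairwise_cons.1 hT
    have := hG.isApproximation D.size (structured_singleton hD0) (spanBound_singleton hD0)
      (fun s hs => ⟨hpos s (by simp [hs]), h3 s hs⟩) h4 (by simp)
    exact ⟨⟨this.1.1.trans hTS, this.1.2⟩, fun q hq =>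
      this.2 q ⟨hq.1.trans hTS.symm, hq.2⟩⟩

/-! ### The program -/

section program

open Term

/-- Functions are called by their position in `program`. The root of the heap of sizes is the
largest size, whose disk gets footpoint 0; merging the two subheaps deletes it. -/
def mainBody : Term :=
  bind (call 1 (pair (var 0) nil)) <|
  bind (fst (fst (snd (var 0)))) <|
  bind (pair (var 0) (const 0)) <|
  bind (arith .mul (var 1) (var 1)) <|
  call 5 (pair (call 2 (snd (snd (var 3))))
    (pair (pair (var 1) nil) (pair nil (pair (var 1) (pair (var 1)
      (pair (arith .sub (const 0) (var 0)) (var 0)))))))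

/-- Inserts the members of a list of numbers into a heap. -/
def buildBody : Term :=
  bind (fst (var 0)) <|
  ifNil (var 0) (snd (var 1)) <|
    call 1 (pair (snd (var 0))
      (call 2 (pair (pair (const 1) (pair (pair (fst (var 0)) nil) (pair nil nil))) (snd (var 1)))))

/-- Merges two leftist heaps. -/
def mergeBody : Term :=
  bind (fst (var 0)) <|
  bind (snd (var 1)) <|
  ifNil (var 1) (var 0) <|
  ifNil (var 0) (var 1) <|
  ifLe (fst (fst (snd (var 1)))) (fst (fst (snd (var 0))))
    (call 3 (pair (fst (snd (var 0))) (pair (fst (snd (snd (var 0))))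
      (call 2 (pair (snd (snd (snd (var 0)))) (var 1))))))
    (call 3 (pair (fst (snd (var 1))) (pair (fst (snd (snd (var 1))))
      (call 2 (pair (snd (snd (snd (var 1)))) (var 0))))))

/-- Makes a node of a leftist heap from its entry and its two subheaps. -/
def nodeBody : Term :=
  bind (fst (snd (var 0))) <|
  bind (snd (snd (var 1))) <|
  bind (ifNil (var 0) (const 0) (fst (var 0))) <|
  bind (ifNil (var 2) (const 0) (fst (var 2))) <|
  ifLe (var 1) (var 0)
    (pair (arith .add (var 1) (const 1)) (pair (fst (var 4)) (pair (var 3) (var 2))))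
    (pair (arith .add (var 0) (const 1)) (pair (fst (var 4)) (pair (var 2) (var 3))))

/-- Inserts the gap between two disks into the heap of gaps. -/
def pushGapBody : Term :=
  bind (fst (fst (var 0))) <|
  bind (snd (fst (var 1))) <|
  call 2 (pair
    (pair (const 1) (pair (pair
      (arith .div (arith .sub (snd (var 0)) (snd (var 1)))
        (arith .mul (const 2) (arith .add (fst (var 1)) (fst (var 0)))))
      (fst (var 2))) (pair nil nil)))
    (snd (var 2)))

/-- Heapsort interleaved with placing: the root is the next size, and the merged subheaps hold the
sizes that remain. -/
def loopBody : Term :=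
  bind (fst (var 0)) <|
  ifNil (var 0) (fst (snd (var 1))) <|
    call 5 (pair (call 2 (snd (snd (var 0))))
      (call 6 (pair (fst (fst (snd (var 0)))) (snd (var 1)))))

/-- Places a disk. -/
def stepBody : Term :=
  bind (fst (snd (snd (var 0)))) <|
  ifNil (var 0) (call 8 (var 1)) <|
  ifLe (fst (var 1)) (fst (fst (snd (var 0)))) (call 7 (var 1)) (call 8 (var 1))

/-- Places a disk in the largest gap. -/
def stepGapBody : Term :=
  bind (fst (var 0)) <|
  bind (fst (snd (snd (var 1)))) <|
  bind (snd (fst (snd (var 0)))) <|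
  bind (fst (var 0)) <|
  bind (snd (var 1)) <|
  bind (ifLe (fst (var 1)) (fst (var 0))
    (arith .add (snd (var 1)) (arith .mul (arith .mul (const 2) (var 4)) (fst (var 1))))
    (arith .sub (snd (var 0)) (arith .mul (arith .mul (const 2) (var 4)) (fst (var 0))))) <|
  bind (pair (var 5) (var 0)) <|
  pair (pair (var 0) (fst (snd (var 7))))
    (pair (call 4 (pair (pair (var 3) (var 0)) (call 4 (pair (pair (var 0) (var 2))
      (call 2 (snd (snd (var 5))))))))
    (snd (snd (snd (var 7)))))

/-- This and `placeRight` run in the environment `endEnv`: variables 2 and 3 are the right and the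
left candidate, 4 and 5 the last and the first disk, 6 the data of the ends and 8 the whole
argument. -/
def placeLeft (l : Term) : Term :=
  pair (pair (var 3) (fst (snd (var 8))))
    (pair (call 4 (pair (pair (var 3) (var 5)) (fst (snd (snd (var 8))))))
    (pair (var 3) (pair (var 4) (pair l (snd (snd (snd (var 6))))))))

def placeRight (r : Term) : Term :=
  pair (pair (var 2) (fst (snd (var 8))))
    (pair (call 4 (pair (pair (var 4) (var 2)) (fst (snd (snd (var 8))))))
    (pair (var 5) (pair (var 2) (pair (fst (snd (snd (var 6)))) r))))

/-- Places a disk at an end. -/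
def stepEndBody : Term :=
  bind (fst (var 0)) <|
  bind (snd (snd (snd (var 1)))) <|
  bind (fst (var 0)) <|
  bind (fst (snd (var 1))) <|
  bind (pair (var 3)
    (arith .sub (snd (var 1)) (arith .mul (arith .mul (const 2) (var 3)) (fst (var 1))))) <|
  bind (pair (var 4)
    (arith .add (snd (var 1)) (arith .mul (arith .mul (const 2) (var 4)) (fst (var 1))))) <|
  bind (arith .sub (snd (var 1)) (arith .mul (var 5) (var 5))) <|
  bind (arith .add (snd (var 1)) (arith .mul (var 6) (var 6))) <|
  ifLe (fst (snd (snd (var 6)))) (var 1) (placeLeft (fst (snd (snd (var 6))))) <|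
  ifLe (var 0) (snd (snd (snd (var 6)))) (placeRight (snd (snd (snd (var 6))))) <|
  ifLe (fst (var 5)) (fst (var 4)) (placeRight (var 0)) (placeLeft (var 1))

def program : Program :=
  [mainBody, buildBody, mergeBody, nodeBody, pushGapBody, loopBody, stepBody, stepGapBody,
    stepEndBody]

end program

variable {P : Program} {env : List Value}

theorem Eval.zero : Eval P env (.const 0) (.num 0) 1 := by
  simpa using Eval.const (P := P) (env := env) 0

theorem Eval.one : Eval P env (.const 1) (.num 1) 1 := by
  simpa using Eval.const (P := P) (env := env) 1

theorem Eval.two : Eval P env (.const 2) (.num 2) 1 := by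
  simpa using Eval.const (P := P) (env := env) 2

/-! ### Leftist heaps -/

inductive Heap
  | nil
  | node (rank : ℕ) (key : ℝ) (val : Value) (l r : Heap)

namespace Heap

def toValue : Heap → Value
  | nil => .nil
  | node n k v l r => .pair (.num n) (.pair (.pair (.num k) v) (.pair l.toValue r.toValue))

def toList : Heap → List (ℝ × Value)
  | nil => []
  | node _ k v l r => (k, v) :: (l.toList ++ r.toList)

def rank : Heap → ℕ
  | nil => 0
  | node n _ _ _ _ => n

/-- The heap is leftist, and the keys decrease from the root to the leaves. -/
def Ok : Heap → Prop
  | nil => True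
  | node n k _ l r => n = r.rank + 1 ∧ r.rank ≤ l.rank ∧ (∀ x ∈ l.toList ++ r.toList, x.1 ≤ k) ∧
      l.Ok ∧ r.Ok

/-- Both subheaps of a node of rank `n` have rank at least `n-1`. -/
theorem two_pow_rank_le : ∀ {h : Heap}, h.Ok → 2 ^ h.rank ≤ h.toList.length + 1
  | nil, _ => by simp [rank, toList]
  | node n k v l r, ⟨hn, hle, _, hl, hr⟩ => by
    have h1 := two_pow_rank_le hl
    have h2 := two_pow_rank_le hr
    have h3 : 2 ^ r.rank ≤ 2 ^ l.rank := Nat.pow_le_pow_right (by norm_num) hle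
    change 2 ^ n ≤ _
    simp only [toList, hn, List.length_cons, List.length_append, pow_succ]
    omega

theorem rank_le_log {h : Heap} (hh : h.Ok) {N : ℕ} (hN : h.toList.length < N) :
    h.rank ≤ Nat.log 2 N :=
  Nat.le_log_of_pow_le (by norm_num) ((two_pow_rank_le hh).trans hN)

def singleton (k : ℝ) (v : Value) : Heap := node 1 k v nil nil

theorem singleton_ok (k : ℝ) (v : Value) : (singleton k v).Ok := by
  simp [singleton, Ok, rank, toList]

theorem toValue_node_ne {n : ℕ} {k : ℝ} {v : Value} {l r : Heap} :
    (node n k v l r).toValue ≠ .nil := by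
  simp [toValue]

theorem exists_eval_rank (h : Heap) {i : ℕ} (hi : env[i]? = some h.toValue) :
    ∃ t ≤ 5, Eval P env (.ifNil (.var i) (.const 0) (.fst (.var i))) (.num h.rank) t := by
  cases h with
  | nil =>
    have h0 : Eval P env (.const 0) (.num (nil.rank : ℕ)) 1 := by simpa [rank] using Eval.zero
    exact ⟨_, by norm_num, .ifNilTrue (.var hi) h0⟩
  | node n k v l r =>
    refine ⟨_, ?_, .ifNilFalse (.var hi) toValue_node_ne (.fst (.var hi))⟩
    norm_num

/-- The subheap of smaller rank becomes the right one, which restores the leftist condition. -/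
theorem exists_eval_node (k : ℝ) (v : Value) {l r : Heap} (hl : l.Ok) (hr : r.Ok)
    (hk : ∀ x ∈ l.toList ++ r.toList, x.1 ≤ k) :
    ∃ h : Heap, h.Ok ∧ h.toList.Perm ((k, v) :: (l.toList ++ r.toList)) ∧ ∃ t ≤ 50,
      Eval program [.pair (.pair (.num k) v) (.pair l.toValue r.toValue)] nodeBody h.toValue t := by
  have key : ∀ (h : Heap), (∃ t ≤ 20, Eval program
      [.num l.rank, .num r.rank, r.toValue, l.toValue,
        .pair (.pair (.num k) v) (.pair l.toValue r.toValue)]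
      (.ifLe (.var 1) (.var 0)
        (.pair (.arith .add (.var 1) (.const 1))
          (.pair (.fst (.var 4)) (.pair (.var 3) (.var 2))))
        (.pair (.arith .add (.var 0) (.const 1))
          (.pair (.fst (.var 4)) (.pair (.var 2) (.var 3))))) h.toValue t) →
      ∃ t ≤ 50, Eval program [.pair (.pair (.num k) v) (.pair l.toValue r.toValue)] nodeBody
        h.toValue t := by
    rintro h ⟨t, ht, he⟩
    obtain ⟨t1, ht1, h1⟩ := exists_eval_rank (P := program)
      (env := [r.toValue, l.toValue, .pair (.pair (.num k) v) (.pair l.toValue r.toValue)])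
      r (i := 0) rfl
    obtain ⟨t2, ht2, h2⟩ := exists_eval_rank (P := program) (env := [.num r.rank, r.toValue,
      l.toValue, .pair (.pair (.num k) v) (.pair l.toValue r.toValue)]) l (i := 2) rfl
    refine ⟨_, ?_, .bind (.fst (.snd (.var rfl))) (.bind (.snd (.snd (.var rfl)))
      (.bind h1 (.bind h2 he)))⟩
    omega
  rcases le_or_gt r.rank l.rank with hle | hle
  · have h1 : Eval program [.num l.rank, .num r.rank, r.toValue, l.toValue,
        .pair (.pair (.num k) v) (.pair l.toValue r.toValue)]
        (.arith .add (.var 1) (.const 1)) (.num (r.rank + 1 : ℕ)) 3 := by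
      rw [Nat.cast_succ]
      exact .arith (o := .add) (.var rfl) .one trivial
    refine ⟨node (r.rank + 1) k v l r, ⟨rfl, hle, hk, hl, hr⟩, .refl _, key _ ⟨_, ?_,
      .ifLeTrue (.var rfl) (.var rfl) (by exact_mod_cast hle) (.pair h1 (.pair (.fst (.var rfl))
        (.pair (.var rfl) (.var rfl))))⟩⟩
    · norm_num
  · have h1 : Eval program [.num l.rank, .num r.rank, r.toValue, l.toValue,
        .pair (.pair (.num k) v) (.pair l.toValue r.toValue)]
        (.arith .add (.var 0) (.const 1)) (.num (l.rank + 1 : ℕ)) 3 := by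
      rw [Nat.cast_succ]
      exact .arith (o := .add) (.var rfl) .one trivial
    refine ⟨node (l.rank + 1) k v r l, ⟨rfl, hle.le, ?_, hr, hl⟩, ?_, key _ ⟨_, ?_,
      .ifLeFalse (.var rfl) (.var rfl) (by exact_mod_cast hle) (.pair h1 (.pair (.fst (.var rfl))
        (.pair (.var rfl) (.var rfl))))⟩⟩
    · intro x hx
      exact hk x (by simp only [List.mem_append] at hx ⊢; tauto)
    · exact List.Perm.cons _ List.perm_append_comm
    · norm_num

/-- Each recursive call descends along a right spine and lowers the sum of the ranks by one. -/
theorem exists_eval_merge : ∀ (n : ℕ) (g h : Heap), g.Ok → h.Ok → g.rank + h.rank = n →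
    ∃ m : Heap, m.Ok ∧ m.toList.Perm (g.toList ++ h.toList) ∧ ∃ t ≤ 100 * n + 100,
      Eval program [.pair g.toValue h.toValue] mergeBody m.toValue t := by
  intro n
  induction n using Nat.strong_induction_on with
  | _ n ih =>
    intro g h hg hh hn
    match g, h, hg, hh, hn with
    | nil, h, _, hh, hn =>
      refine ⟨h, hh, by simp [toList], _, ?_, .bind (.fst (.var rfl)) (.bind (.snd (.var rfl))
        (.ifNilTrue (.var rfl) (.var rfl)))⟩
      omega
    | node a k v l r, nil, hg, _, hn =>
      refine ⟨node a k v l r, hg, by simp [toList], _, ?_, .bind (.fst (.var rfl))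
        (.bind (.snd (.var rfl)) (.ifNilFalse (.var rfl) toValue_node_ne
          (.ifNilTrue (.var rfl) (.var rfl))))⟩
      omega
    | node a k v l r, node a' k' v' l' r', hg, hh, hn =>
      obtain ⟨ha, hle, hk, hl, hr⟩ := id hg
      obtain ⟨ha', hle', hk', hl', hr'⟩ := id hh
      simp only [rank] at hn
      rcases le_or_gt k k' with hkk | hkk
      · obtain ⟨m, hm, hmp, t, ht, he⟩ := ih (r'.rank + a) (by omega) r' (node a k v l r) hr' hg rfl
        obtain ⟨m', hm', hmp', t', ht', he'⟩ := exists_eval_node k' v' hl' hm (fun x hx => by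
          rw [List.mem_append, hmp.mem_iff] at hx
          simp only [toList, List.mem_append, List.mem_cons] at hx hk hk'
          rcases hx with hx | hx | rfl | hx
          · exact hk' x (.inl hx)
          · exact hk' x (.inr hx)
          · exact hkk
          · exact (hk x hx).trans hkk)
        refine ⟨m', hm', hmp'.trans ?_, _, ?_, .bind (.fst (.var rfl)) (.bind (.snd (.var rfl))
          (.ifNilFalse (.var rfl) toValue_node_ne (.ifNilFalse (.var rfl) toValue_node_ne
          (.ifLeTrue (.fst (.fst (.snd (.var rfl)))) (.fst (.fst (.snd (.var rfl)))) hkk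
            (.call (.pair (.fst (.snd (.var rfl))) (.pair (.fst (.snd (.snd (.var rfl))))
              (.call (.pair (.snd (.snd (.snd (.var rfl)))) (.var rfl)) rfl he))) rfl he')))))⟩
        · simp only [toList]
          refine ((hmp.append_left l'.toList).cons _).trans ?_
          simp only [toList]
          rw [← List.append_assoc, ← List.cons_append]
          exact List.perm_append_comm
        · omega
      · obtain ⟨m, hm, hmp, t, ht, he⟩ :=
          ih (r.rank + a') (by omega) r (node a' k' v' l' r') hr hh rfl
        obtain ⟨m', hm', hmp', t', ht', he'⟩ := exists_eval_node k v hl hm (fun x hx => by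
          rw [List.mem_append, hmp.mem_iff] at hx
          simp only [toList, List.mem_append, List.mem_cons] at hx hk hk'
          rcases hx with hx | hx | rfl | hx
          · exact hk x (.inl hx)
          · exact hk x (.inr hx)
          · exact hkk.le
          · exact (hk' x hx).trans hkk.le)
        refine ⟨m', hm', hmp'.trans ?_, _, ?_, .bind (.fst (.var rfl)) (.bind (.snd (.var rfl))
          (.ifNilFalse (.var rfl) toValue_node_ne (.ifNilFalse (.var rfl) toValue_node_ne
          (.ifLeFalse (.fst (.fst (.snd (.var rfl)))) (.fst (.fst (.snd (.var rfl)))) hkk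
            (.call (.pair (.fst (.snd (.var rfl))) (.pair (.fst (.snd (.snd (.var rfl))))
              (.call (.pair (.snd (.snd (.snd (.var rfl)))) (.var rfl)) rfl he))) rfl he')))))⟩
        · simp only [toList]
          refine ((hmp.append_left l.toList).cons _).trans ?_
          simp only [toList]
          rw [← List.append_assoc, List.cons_append]
        · omega

/-- Merging takes logarithmic time. -/
theorem exists_eval_call_merge {g h : Heap} (hg : g.Ok) (hh : h.Ok) {N : ℕ}
    (hgN : g.toList.length < N) (hhN : h.toList.length < N) :
    ∃ m : Heap, m.Ok ∧ m.toList.Perm (g.toList ++ h.toList) ∧ ∃ T ≤ 200 * Nat.log 2 N + 101,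
      ∀ {env : List Value} {e : Term} {t : ℕ},
        Eval program env e (.pair g.toValue h.toValue) t →
        Eval program env (.call 2 e) m.toValue (t + T) := by
  obtain ⟨m, hm, hp, t, ht, he⟩ := exists_eval_merge _ g h hg hh rfl
  have h1 := rank_le_log hg hgN
  have h2 := rank_le_log hh hhN
  exact ⟨m, hm, hp, t + 1, by omega, fun h' => .call h' rfl he⟩

end Heap

/-! ### The heap of gaps -/

def Disk.toValue (D : Disk) : Value := .pair (.num D.size) (.num D.foot)

/-- The size of the largest disk that fits between `A` and `B`, and the two disks. -/
noncomputable def gapEntry (g : Disk × Disk) : ℝ × Value :=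
  ((g.2.foot - g.1.foot) / (2 * (g.1.size + g.2.size)), .pair g.1.toValue g.2.toValue)

/-- `T` is the cost of the call beyond that of its argument, so the result can be plugged into any
larger evaluation. -/
theorem exists_eval_pushGap {A B : Disk} (hA : 0 < A.size) (hB : 0 < B.size) {G : Heap}
    (hG : G.Ok) {N : ℕ} (hN : G.toList.length < N) (hN1 : 1 < N) :
    ∃ m : Heap, m.Ok ∧ m.toList.Perm (gapEntry (A, B) :: G.toList) ∧
      ∃ T ≤ 200 * Nat.log 2 N + 150, ∀ {env : List Value} {e : Term} {t : ℕ},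
        Eval program env e (.pair (.pair A.toValue B.toValue) G.toValue) t →
        Eval program env (.call 4 e) m.toValue (t + T) := by
  obtain ⟨m, hm, hp, T, hT, he⟩ := Heap.exists_eval_call_merge
    (Heap.singleton_ok (gapEntry (A, B)).1 (gapEntry (A, B)).2) hG
    (by simpa [Heap.singleton, Heap.toList] using hN1) hN
  refine ⟨m, hm, by simpa [Heap.singleton, Heap.toList] using hp, ?_⟩
  have hne : (2 * (A.size + B.size)) ≠ 0 := by positivity
  have hkey : Eval program [B.toValue, A.toValue, .pair (.pair A.toValue B.toValue) G.toValue]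
      (.arith .div (.arith .sub (.snd (.var 0)) (.snd (.var 1)))
        (.arith .mul (.const 2) (.arith .add (.fst (.var 1)) (.fst (.var 0)))))
      (.num ((B.foot - A.foot) / (2 * (A.size + B.size)))) 13 :=
    .arith (o := .div) (.arith (o := .sub) (.snd (.var rfl)) (.snd (.var rfl)) trivial)
      (.arith (o := .mul) .two (.arith (o := .add) (.fst (.var rfl)) (.fst (.var rfl)) trivial)
        trivial) hne
  have hone : Eval program [B.toValue, A.toValue, .pair (.pair A.toValue B.toValue) G.toValue]
      (.const 1) (.num (1 : ℕ)) 1 := by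
    rw [Nat.cast_one]; exact .one
  have hbody : ∃ t ≤ 200 * Nat.log 2 N + 149,
      Eval program [.pair (.pair A.toValue B.toValue) G.toValue] pushGapBody m.toValue t :=
    ⟨_, by omega, .bind (.fst (.fst (.var rfl))) (.bind (.snd (.fst (.var rfl)))
      (he (.pair (.pair hone (.pair (.pair hkey (.fst (.var rfl))) (.pair .nil .nil)))
        (.snd (.var rfl)))))⟩
  obtain ⟨t, ht, hb⟩ := hbody
  exact ⟨t + 1, by omega, fun h => .call h rfl hb⟩

/-! ### Updating the list of gaps -/

/-- `l` lists the pairs of consecutive disks of `p`. -/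
structure IsGapList (p : List Disk) (l : List (Disk × Disk)) : Prop where
  nodup : l.Nodup
  mem_iff : ∀ A B, (A, B) ∈ l ↔ Consecutive p A B
  length_lt : l.length < p.length

theorem InsertStep.next_iff {φ : Disk → ℝ} {p : List Disk} {A B D : Disk}
    (h : Packed p D.size) (hφ : IsDirection φ) (hs : InsertStep φ p D A B) (X Y : Disk) :
    Next φ (D :: p) X Y ↔
      (X = A ∧ Y = D) ∨ (X = D ∧ Y = B) ∨ (Next φ p X Y ∧ ¬ (X = A ∧ Y = B)) := by
  constructor
  · intro hXY
    rcases hs.next_cases h hφ hXY with h1 | h1 | ⟨-, -, h1, h2, -⟩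
    · exact .inl h1
    · exact .inr (.inl h1)
    · exact .inr (.inr ⟨h1, fun h3 => h2 h3.1⟩)
  · rintro (⟨rfl, rfl⟩ | ⟨rfl, rfl⟩ | ⟨h1, h2⟩)
    · exact hs.next_left h
    · exact hs.next_right h
    · refine hs.next_cons h hφ h1 fun hX => h2 ⟨hX, ?_⟩
      subst hX
      exact h1.unique_right h hφ hs.1

theorem EndStep.next_iff {φ : Disk → ℝ} {p : List Disk} {A D : Disk}
    (h : Packed p D.size) (hφ : IsDirection φ) (hs : EndStep φ p D A) (X Y : Disk) :
    Next φ (D :: p) X Y ↔ (X = D ∧ Y = A) ∨ Next φ p X Y := by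
  constructor
  · intro hXY
    rcases hs.next_cases h hφ hXY with h1 | ⟨-, -, h1⟩
    · exact .inl h1
    · exact .inr h1
  · rintro (⟨rfl, rfl⟩ | h1)
    · exact hs.next h
    · exact hs.next_cons h h1

theorem IsGapList.insert {p : List Disk} {l l' : List (Disk × Disk)} {A B D : Disk}
    (hl : IsGapList p l) (hp : l.Perm ((A, B) :: l')) (hD : D ∉ p)
    (h : ∀ X Y, Consecutive (D :: p) X Y ↔
      (X = A ∧ Y = D) ∨ (X = D ∧ Y = B) ∨ (Consecutive p X Y ∧ ¬ (X = A ∧ Y = B))) :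
    IsGapList (D :: p) ((A, D) :: (D, B) :: l') := by
  have hnd := hp.nodup_iff.1 hl.nodup
  obtain ⟨hAB, hl'⟩ := List.nodup_cons.1 hnd
  have hmem : ∀ X Y, (X, Y) ∈ l' ↔ Consecutive p X Y ∧ ¬ (X = A ∧ Y = B) := by
    intro X Y
    rw [← hl.mem_iff, hp.mem_iff, List.mem_cons, Prod.mk.injEq]
    constructor
    · intro hXY
      exact ⟨.inr hXY, fun h' => hAB (by rwa [h'.1, h'.2] at hXY)⟩
    · rintro ⟨h1 | h1, h2⟩
      · exact absurd h1 h2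
      · exact h1
  have hA : A ∈ p := ((hl.mem_iff A B).1 (hp.mem_iff.2 (by simp))).1
  refine ⟨?_, ?_, ?_⟩
  · refine List.nodup_cons.2 ⟨?_, List.nodup_cons.2 ⟨?_, hl'⟩⟩
    · rw [List.mem_cons, hmem, Prod.mk.injEq]
      rintro (⟨rfl, -⟩ | ⟨h1, -⟩)
      · exact hD hA
      · exact hD h1.2.1
    · rw [hmem]
      rintro ⟨h1, -⟩
      exact hD h1.1
  · intro X Y
    rw [h, List.mem_cons, List.mem_cons, hmem, Prod.mk.injEq, Prod.mk.injEq]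
  · have h1 := hl.length_lt
    have h2 := hp.length_eq
    simp only [List.length_cons] at h2 ⊢
    omega

theorem IsGapList.cons {p : List Disk} {l : List (Disk × Disk)} {A B D : Disk}
    (hl : IsGapList p l) (hD : D ∉ p) (hAB : A = D ∨ B = D)
    (h : ∀ X Y, Consecutive (D :: p) X Y ↔ (X = A ∧ Y = B) ∨ Consecutive p X Y) :
    IsGapList (D :: p) ((A, B) :: l) := by
  refine ⟨List.nodup_cons.2 ⟨?_, hl.nodup⟩, ?_, ?_⟩
  · rw [hl.mem_iff]
    intro h1
    rcases hAB with rfl | rfl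
    · exact hD h1.1
    · exact hD h1.2.1
  · intro X Y
    rw [h, List.mem_cons, hl.mem_iff, Prod.mk.injEq]
  · have := hl.length_lt
    simp only [List.length_cons]
    omega

/-! ### A step of the program -/

/-- The data on which the main loop works: a placement, the heap of its gaps, its first and its
last disk, and the abscissae of its leftmost and its rightmost point. -/
structure State where
  placement : List Disk
  gaps : Heap
  first : Disk
  last : Disk
  left : ℝ
  right : ℝ

namespace State

def ends (s : State) : Value :=
  .pair s.first.toValue (.pair s.last.toValue (.pair (.num s.left) (.num s.right)))

def toValue (s : State) : Value :=
  .pair (encodePlacement s.placement) (.pair s.gaps.toValue s.ends)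

structure Ok (s : State) (d : ℝ) : Prop where
  structured : Structured s.placement d
  first : IsLeftmost s.placement s.first
  last : IsRightmost s.placement s.last
  extent : Extent s.placement s.left s.right
  heap : s.gaps.Ok
  gaps : ∃ l, IsGapList s.placement l ∧ s.gaps.toList.Perm (l.map gapEntry)

end State

theorem consecutive_iff_of_insertStep {p : List Disk} {A B D : Disk} (h : Packed p D.size)
    (hs : InsertStep Disk.foot p D A B ∨ InsertStep (-Disk.foot) p D B A) (X Y : Disk) :
    Consecutive (D :: p) X Y ↔
      (X = A ∧ Y = D) ∨ (X = D ∧ Y = B) ∨ (Consecutive p X Y ∧ ¬ (X = A ∧ Y = B)) := by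
  rcases hs with hs | hs
  · exact hs.next_iff h isDirection_foot X Y
  · have := hs.next_iff h isDirection_foot.neg Y X
    rw [next_neg_iff, next_neg_iff, next_foot_iff, next_foot_iff] at this
    rw [this]
    tauto

/-- The state after a step that places `D` in a gap. -/
theorem State.Ok.insert {s : State} {d : ℝ} (hs : s.Ok d) {A B D : Disk} (hle : D.size ≤ d)
    (hD : 0 < D.size)
    (hstep : InsertStep Disk.foot s.placement D A B ∨ InsertStep (-Disk.foot) s.placement D B A)
    {l l' : List (Disk × Disk)} (hl : IsGapList s.placement l) (hp : l.Perm ((A, B) :: l'))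
    {G : Heap} (hG : G.Ok) (hGl : G.toList.Perm (((A, D) :: (D, B) :: l').map gapEntry)) :
    State.Ok ⟨D :: s.placement, G, s.first, s.last, s.left, s.right⟩ D.size := by
  have hP := hs.structured.toPacked.mono hD hle
  obtain ⟨φ, X, Y, hφ, hXY⟩ : ∃ φ X Y, IsDirection φ ∧ InsertStep φ s.placement D X Y := by
    rcases hstep with h | h
    · exact ⟨_, _, _, isDirection_foot, h⟩
    · exact ⟨_, _, _, isDirection_foot.neg, h⟩
  have hlt : A.foot < D.foot ∧ D.foot < B.foot := by
    rcases hstep with h | h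
    · exact h.lt hP
    · have := h.lt hP
      simp only [Pi.neg_apply, neg_lt_neg_iff] at this
      exact ⟨this.2, this.1⟩
  have hAB : Consecutive s.placement A B := (hl.mem_iff A B).1 (hp.mem_iff.2 (by simp))
  have hstr := hXY.structured hs.structured hle hD hφ
  refine ⟨hstr, ⟨by simp [hs.first.1], ?_⟩, ⟨by simp [hs.last.1], ?_⟩, hXY.extent hP hφ hs.extent,
    hG, _, hl.insert hp (List.nodup_cons.1 hstr.nodup).1
      (consecutive_iff_of_insertStep hP hstep), hGl⟩
  · intro E hE
    rcases List.mem_cons.1 hE with rfl | hE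
    · exact (hs.first.2 A hAB.1).trans hlt.1.le
    · exact hs.first.2 E hE
  · intro E hE
    rcases List.mem_cons.1 hE with rfl | hE
    · exact hlt.2.le.trans (hs.last.2 B hAB.2.1)
    · exact hs.last.2 E hE

/-- The state after a step that places `D` at the left end. -/
theorem State.Ok.consLeft {s : State} {d : ℝ} (hs : s.Ok d) {D : Disk} (hle : D.size ≤ d)
    (hD : 0 < D.size) (hstep : EndStep Disk.foot s.placement D s.first)
    {G : Heap} (hG : G.Ok) (hGl : G.toList.Perm (gapEntry (D, s.first) :: s.gaps.toList)) :
    State.Ok ⟨D :: s.placement, G, D, s.last, min s.left D.leftmostPoint, s.right⟩ D.size := by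
  have hP := hs.structured.toPacked.mono hD hle
  have hstr := hstep.structured hs.structured hle hD isDirection_foot
  obtain ⟨l, hl, hlp⟩ := hs.gaps
  have hr : D.rightmostPoint ≤ s.right := by
    have h1 := hs.extent.right_le _ hs.first.1
    have h2 := hstep.2
    have h3 := hP.le_size _ hs.first.1
    unfold Disk.rightmostPoint Disk.radius at *
    nlinarith
  refine ⟨hstr, ⟨by simp, ?_⟩, ⟨by simp [hs.last.1], ?_⟩, ?_, hG, (D, s.first) :: l,
    hl.cons (List.nodup_cons.1 hstr.nodup).1 (.inl rfl) (hstep.next_iff hP isDirection_foot),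
    hGl.trans (hlp.cons _)⟩
  · intro E hE
    rcases List.mem_cons.1 hE with rfl | hE
    · exact le_rfl
    · exact (hstep.lt hP hE).le
  · intro E hE
    rcases List.mem_cons.1 hE with rfl | hE
    · exact (hstep.lt hP hs.last.1).le
    · exact hs.last.2 E hE
  · have := hs.extent.cons D
    rwa [max_eq_left hr] at this

/-- The state after a step that places `D` at the right end. -/
theorem State.Ok.consRight {s : State} {d : ℝ} (hs : s.Ok d) {D : Disk} (hle : D.size ≤ d)
    (hD : 0 < D.size) (hstep : EndStep (-Disk.foot) s.placement D s.last)
    {G : Heap} (hG : G.Ok) (hGl : G.toList.Perm (gapEntry (s.last, D) :: s.gaps.toList)) :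
    State.Ok ⟨D :: s.placement, G, s.first, D, s.left, max s.right D.rightmostPoint⟩ D.size := by
  have hP := hs.structured.toPacked.mono hD hle
  have hstr := hstep.structured hs.structured hle hD isDirection_foot.neg
  obtain ⟨l, hl, hlp⟩ := hs.gaps
  have hlt : ∀ E ∈ s.placement, E.foot < D.foot := fun E hE => by
    simpa using hstep.lt hP hE
  have hr : s.left ≤ D.leftmostPoint := by
    have h1 := hs.extent.le_left _ hs.last.1
    have h2 := hstep.2
    have h3 := hP.le_size _ hs.last.1
    unfold Disk.leftmostPoint Disk.radius at *
    simp only [Pi.neg_apply] at h2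
    nlinarith
  refine ⟨hstr, ⟨by simp [hs.first.1], ?_⟩, ⟨by simp, ?_⟩, ?_, hG, (s.last, D) :: l,
    hl.cons (List.nodup_cons.1 hstr.nodup).1 (.inr rfl) fun X Y => ?_,
    hGl.trans (hlp.cons _)⟩
  · intro E hE
    rcases List.mem_cons.1 hE with rfl | hE
    · exact (hlt _ hs.first.1).le
    · exact hs.first.2 E hE
  · intro E hE
    rcases List.mem_cons.1 hE with rfl | hE
    · exact le_rfl
    · exact (hlt E hE).le
  · have := hs.extent.cons D
    rwa [min_eq_left hr] at this
  · have := hstep.next_iff hP isDirection_foot.neg Y X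
    rw [next_neg_iff, next_neg_iff, next_foot_iff, next_foot_iff] at this
    rw [this]
    tauto

/-- Three merges: one deletes the filled gap, two insert the gaps on both sides of the new disk. -/
theorem exists_eval_stepGap {s : State} {d σ : ℝ} (hs : s.Ok d) (hσ : 0 < σ) (hσd : σ ≤ d)
    {n : ℕ} {k : ℝ} {v : Value} {hl hr : Heap} (hG : s.gaps = .node n k v hl hr) (hk : σ ≤ k)
    {N : ℕ} (hN : s.placement.length < N) (hN1 : 1 < N) :
    ∃ (s' : State) (D : Disk), s'.placement = D :: s.placement ∧ D.size = σ ∧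
      GreedyStep s.placement D ∧ s'.Ok σ ∧ ∃ t ≤ 600 * Nat.log 2 N + 600,
        Eval program [.pair (.num σ) s.toValue] stepGapBody s'.toValue t := by
  obtain ⟨l, hgl, hlp⟩ := hs.gaps
  have hheap := hs.heap
  have hsv : s.toValue = .pair (encodePlacement s.placement)
    (.pair (Heap.node n k v hl hr).toValue s.ends) := by rw [State.toValue, hG]
  rw [hG] at hlp hheap
  obtain ⟨-, -, -, hhl, hhr⟩ := hheap
  obtain ⟨⟨A, B⟩, hAB, he⟩ := List.mem_map.1 (hlp.mem_iff.1 List.mem_cons_self)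
  obtain ⟨l', hl'⟩ : ∃ l', l.Perm ((A, B) :: l') := by
    obtain ⟨u, w, rfl⟩ := List.append_of_mem hAB
    exact ⟨_, List.perm_middle⟩
  have hrest : (hl.toList ++ hr.toList).Perm (l'.map gapEntry) := by
    have := hlp.trans (hl'.map gapEntry)
    rw [List.map_cons, he] at this
    exact (List.perm_cons _).1 this
  obtain ⟨rfl, rfl⟩ := Prod.mk.inj he
  have hcons := (hgl.mem_iff A B).1 hAB
  have hA := hs.structured.size_pos hcons.1
  have hB := hs.structured.size_pos hcons.2.1
  have hfit : FitsBetween σ A B := by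
    rw [fitsBetween_iff hσ hA hB]
    rw [le_div_iff₀ (by positivity)] at hk
    linarith
  have hfit' := (fitsBetween_iff hσ hA hB).1 hfit
  have hσA := mul_pos hσ hA
  have hσB := mul_pos hσ hB
  obtain ⟨D, rfl, hstep, hgreedy, t0, ht0, hfoot⟩ : ∃ D : Disk, D.size = σ ∧
      (InsertStep Disk.foot s.placement D A B ∨ InsertStep (-Disk.foot) s.placement D B A) ∧
      GreedyStep s.placement D ∧ ∃ t ≤ 20, ∀ x y z : Value,
        Eval program [B.toValue, A.toValue, x, y, .num σ, z]
          (.ifLe (.fst (.var 1)) (.fst (.var 0))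
            (.arith .add (.snd (.var 1))
              (.arith .mul (.arith .mul (.const 2) (.var 4)) (.fst (.var 1))))
            (.arith .sub (.snd (.var 0))
              (.arith .mul (.arith .mul (.const 2) (.var 4)) (.fst (.var 0)))))
          (.num D.foot) t := by
    rcases le_or_gt A.size B.size with hle | hle
    · have h1 : A.foot < A.foot + 2 * σ * A.size := by linarith
      have h2 : A.foot + 2 * σ * A.size < B.foot := by linarith
      have ht : Disk.Touches ⟨σ, A.foot + 2 * σ * A.size⟩ A := by
        rw [Disk.touches_iff hσ hA, abs_of_pos (sub_pos.2 h1)]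
        simp
      refine ⟨⟨σ, A.foot + 2 * σ * A.size⟩, rfl,
        .inr (insertStep_left hσ hA hB hcons hfit h1 hle ht),
        .gap A B hcons hfit h1 h2 (.inl ⟨hle, ht⟩), _, ?_, fun x y z =>
        .ifLeTrue (.fst (.var rfl)) (.fst (.var rfl)) hle
          (.arith (o := .add) (.snd (.var rfl)) (.arith (o := .mul)
            (.arith (o := .mul) .two (.var rfl) trivial) (.fst (.var rfl)) trivial) trivial)⟩
      norm_num
    · have h1 : A.foot < B.foot - 2 * σ * B.size := by linarith
      have h2 : B.foot - 2 * σ * B.size < B.foot := by linarith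
      have ht : Disk.Touches ⟨σ, B.foot - 2 * σ * B.size⟩ B := by
        rw [Disk.touches_iff hσ hB, abs_sub_comm, abs_of_pos (sub_pos.2 h2)]
        simp
      refine ⟨⟨σ, B.foot - 2 * σ * B.size⟩, rfl,
        .inl (insertStep_right hσ hA hB hcons hfit h2 hle.le ht),
        .gap A B hcons hfit h1 h2 (.inr ⟨hle.le, ht⟩), _, ?_, fun x y z =>
        .ifLeFalse (.fst (.var rfl)) (.fst (.var rfl)) hle
          (.arith (o := .sub) (.snd (.var rfl)) (.arith (o := .mul)
            (.arith (o := .mul) .two (.var rfl) trivial) (.fst (.var rfl)) trivial) trivial)⟩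
      norm_num
  have hlen := hgl.length_lt
  have hlen' : l'.length + 1 = l.length := by simpa using hl'.length_eq.symm
  have hlenr : hl.toList.length + hr.toList.length = l'.length := by
    simpa using hrest.length_eq
  obtain ⟨m, hm, hmp, T, hT, hme⟩ := Heap.exists_eval_call_merge hhl hhr (N := N) (by omega)
    (by omega)
  have hmlen := hmp.length_eq
  rw [List.length_append] at hmlen
  obtain ⟨m1, hm1, hmp1, T1, hT1, hme1⟩ := exists_eval_pushGap hσ hB hm (N := N) (by omega) hN1
  have hmlen1 := hmp1.length_eq
  rw [List.length_cons] at hmlen1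
  obtain ⟨m2, hm2, hmp2, T2, hT2, hme2⟩ := exists_eval_pushGap hA hσ hm1 (N := N) (by omega) hN1
  refine ⟨⟨D :: s.placement, m2, s.first, s.last, s.left, s.right⟩, D, rfl, rfl, hgreedy,
    hs.insert hσd hσ hstep hgl hl' hm2 ?_, ?_⟩
  · exact hmp2.trans ((hmp1.trans ((hmp.trans hrest).cons _)).cons _)
  · rw [hsv]
    refine ⟨_, ?_, .bind (.fst (.var rfl)) (.bind (.fst (.snd (.snd (.var rfl))))
      (.bind (.snd (.fst (.snd (.var rfl)))) (.bind (.fst (.var rfl)) (.bind (.snd (.var rfl))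
      (.bind (hfoot _ _ _) (.bind (.pair (.var rfl) (.var rfl)) (.pair
        (.pair (.var rfl) (.fst (.snd (.var rfl))))
        (.pair (hme2 (.pair (.pair (.var rfl) (.var rfl)) (hme1 (.pair (.pair (.var rfl) (.var rfl))
          (hme (.snd (.snd (.var rfl))))))))
          (.snd (.snd (.snd (.var rfl)))))))))))) ⟩
    omega

def leftCandidate (σ : ℝ) (A : Disk) : Disk := ⟨σ, A.foot - 2 * σ * A.size⟩

def rightCandidate (σ : ℝ) (Z : Disk) : Disk := ⟨σ, Z.foot + 2 * σ * Z.size⟩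

/-- The environment of `stepEndBody` after its local definitions. -/
def endEnv (s : State) (σ : ℝ) : List Value :=
  [.num ((rightCandidate σ s.last).foot + σ * σ), .num ((leftCandidate σ s.first).foot - σ * σ),
    (rightCandidate σ s.last).toValue, (leftCandidate σ s.first).toValue, s.last.toValue,
    s.first.toValue, s.ends, .num σ, .pair (.num σ) s.toValue]

/-- Treats the local definitions once for all four outcomes of the case distinction that follows
them. -/
theorem exists_eval_endEnv (s : State) (σ : ℝ) : ∃ T ≤ 100, ∀ {v : Value} {t : ℕ},
    Eval program (endEnv s σ)
      (.ifLe (.fst (.snd (.snd (.var 6)))) (.var 1) (placeLeft (.fst (.snd (.snd (.var 6)))))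
        (.ifLe (.var 0) (.snd (.snd (.snd (.var 6)))) (placeRight (.snd (.snd (.snd (.var 6)))))
        (.ifLe (.fst (.var 5)) (.fst (.var 4)) (placeRight (.var 0)) (placeLeft (.var 1))))) v t →
    ∃ t' ≤ t + T, Eval program [.pair (.num σ) s.toValue] stepEndBody v t' := by
  refine ⟨100, le_rfl, fun {v t} h => ⟨_, ?_, .bind (.fst (.var rfl))
    (.bind (.snd (.snd (.snd (.var rfl)))) (.bind (.fst (.var rfl)) (.bind (.fst (.snd (.var rfl)))
    (.bind (.pair (.var rfl) (.arith (o := .sub) (.snd (.var rfl)) (.arith (o := .mul)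
      (.arith (o := .mul) .two (.var rfl) trivial) (.fst (.var rfl)) trivial) trivial))
    (.bind (.pair (.var rfl) (.arith (o := .add) (.snd (.var rfl)) (.arith (o := .mul)
      (.arith (o := .mul) .two (.var rfl) trivial) (.fst (.var rfl)) trivial) trivial))
    (.bind (.arith (o := .sub) (.snd (.var rfl)) (.arith (o := .mul) (.var rfl) (.var rfl) trivial)
      trivial)
    (.bind (.arith (o := .add) (.snd (.var rfl)) (.arith (o := .mul) (.var rfl) (.var rfl) trivial)
      trivial) h)))))))⟩⟩
  omega

theorem exists_eval_placeLeft {s : State} {σ : ℝ} {G : Heap} {T : ℕ}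
    (hG : ∀ {env : List Value} {e : Term} {t : ℕ}, Eval program env e
      (.pair (.pair (leftCandidate σ s.first).toValue s.first.toValue) s.gaps.toValue) t →
        Eval program env (.call 4 e) G.toValue (t + T))
    {e : Term} {x : ℝ} {t : ℕ} (he : Eval program (endEnv s σ) e (.num x) t) :
    ∃ t' ≤ t + T + 100, Eval program (endEnv s σ) (placeLeft e)
      (State.toValue ⟨leftCandidate σ s.first :: s.placement, G, leftCandidate σ s.first, s.last,
        x, s.right⟩) t' := by
  refine ⟨_, ?_, .pair (.pair (.var rfl) (.fst (.snd (.var rfl))))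
    (.pair (hG (.pair (.pair (.var rfl) (.var rfl)) (.fst (.snd (.snd (.var rfl))))))
    (.pair (.var rfl) (.pair (.var rfl) (.pair he (.snd (.snd (.snd (.var rfl))))))))⟩
  omega

theorem exists_eval_placeRight {s : State} {σ : ℝ} {G : Heap} {T : ℕ}
    (hG : ∀ {env : List Value} {e : Term} {t : ℕ}, Eval program env e
      (.pair (.pair s.last.toValue (rightCandidate σ s.last).toValue) s.gaps.toValue) t →
        Eval program env (.call 4 e) G.toValue (t + T))
    {e : Term} {x : ℝ} {t : ℕ} (he : Eval program (endEnv s σ) e (.num x) t) :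
    ∃ t' ≤ t + T + 100, Eval program (endEnv s σ) (placeRight e)
      (State.toValue ⟨rightCandidate σ s.last :: s.placement, G, s.first, rightCandidate σ s.last,
        s.left, x⟩) t' := by
  refine ⟨_, ?_, .pair (.pair (.var rfl) (.fst (.snd (.var rfl))))
    (.pair (hG (.pair (.pair (.var rfl) (.var rfl)) (.fst (.snd (.snd (.var rfl))))))
    (.pair (.var rfl) (.pair (.var rfl) (.pair (.fst (.snd (.snd (.var rfl)))) he))))⟩
  omega

theorem exists_eval_stepEnd {s : State} {d σ : ℝ} (hs : s.Ok d) (hσ : 0 < σ) (hσd : σ ≤ d)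
    (hgap : NoGap s.placement σ) {N : ℕ} (hN : s.placement.length < N) (hN1 : 1 < N) :
    ∃ (s' : State) (D : Disk), s'.placement = D :: s.placement ∧ D.size = σ ∧
      GreedyStep s.placement D ∧ s'.Ok σ ∧ ∃ t ≤ 600 * Nat.log 2 N + 600,
        Eval program [.pair (.num σ) s.toValue] stepEndBody s'.toValue t := by
  have hA := hs.structured.size_pos hs.first.1
  have hZ := hs.structured.size_pos hs.last.1
  set L := leftCandidate σ s.first with hL
  set R := rightCandidate σ s.last with hR
  have hLs : L.size = σ := rfl
  have hRs : R.size = σ := rfl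
  have hLc : IsLeftCandidate σ s.first L :=
    (isLeftCandidate_iff hσ hA).2 ⟨rfl, by simp [hL, leftCandidate]⟩
  have hRc : IsRightCandidate σ s.last R :=
    (isRightCandidate_iff hσ hZ).2 ⟨rfl, by simp [hR, rightCandidate]⟩
  have hLe : EndStep Disk.foot s.placement L s.first := endStep_left hσ hs.first hA hLc
  have hRe : EndStep (-Disk.foot) s.placement R s.last := endStep_right hσ hs.last hZ hRc
  obtain ⟨l, hgl, hlp⟩ := hs.gaps
  have hlen : s.gaps.toList.length < N := by
    have h1 := hlp.length_eq
    have h2 := hgl.length_lt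
    rw [List.length_map] at h1
    omega
  obtain ⟨Gl, hGL, hGLp, TL, hTL, hGLe⟩ := exists_eval_pushGap (A := L) hσ hA hs.heap hlen hN1
  obtain ⟨Gr, hGR, hGRp, TR, hTR, hGRe⟩ := exists_eval_pushGap (B := R) hZ hσ hs.heap hlen hN1
  have hLok := hs.consLeft (D := L) hσd hσ hLe hGL hGLp
  have hRok := hs.consRight (D := R) hσd hσ hRe hGR hGRp
  -- The left candidate leaves the rightmost point unchanged, so its left abscissa alone decides
  -- whether the span grows; symmetrically for `R`.
  have hspanL : span (L :: s.placement) = s.right - min s.left L.leftmostPoint :=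
    hLok.extent.span_eq
  have hspanR : span (R :: s.placement) = max s.right R.rightmostPoint - s.left :=
    hRok.extent.span_eq
  have hspan := hs.extent.span_eq
  have hLl : L.leftmostPoint = L.foot - σ * σ := by
    rw [Disk.leftmostPoint, Disk.radius, hLs, sq]
  have hRr : R.rightmostPoint = R.foot + σ * σ := by
    rw [Disk.rightmostPoint, Disk.radius, hRs, sq]
  rw [hLl] at hspanL hLok
  rw [hRr] at hspanR hRok
  obtain ⟨T0, hT0, hbody⟩ := exists_eval_endEnv s σ
  rcases le_or_gt s.left (L.foot - σ * σ) with h1 | h1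
  · rw [min_eq_left h1] at hspanL hLok
    obtain ⟨t, ht, he⟩ := exists_eval_placeLeft hGLe (e := .fst (.snd (.snd (.var 6))))
      (x := s.left) (.fst (.snd (.snd (.var rfl))))
    obtain ⟨t', ht', he'⟩ := hbody (.ifLeTrue (.fst (.snd (.snd (.var rfl)))) (.var rfl) h1 he)
    exact ⟨_, L, rfl, rfl, .freeEnd s.first s.last hgap hs.first hs.last (.inl hLc) (by linarith),
      hLok, t', by omega, he'⟩
  · have hL' : span s.placement < span (L :: s.placement) := by
      rw [hspan, hspanL, min_eq_right h1.le]
      linarith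
    rcases le_or_gt (R.foot + σ * σ) s.right with h2 | h2
    · rw [max_eq_left h2] at hspanR hRok
      obtain ⟨t, ht, he⟩ := exists_eval_placeRight hGRe (e := .snd (.snd (.snd (.var 6))))
        (x := s.right) (.snd (.snd (.snd (.var rfl))))
      obtain ⟨t', ht', he'⟩ := hbody (.ifLeFalse (.fst (.snd (.snd (.var rfl)))) (.var rfl) h1
        (.ifLeTrue (.var rfl) (.snd (.snd (.snd (.var rfl)))) h2 he))
      exact ⟨_, R, rfl, rfl, .freeEnd s.first s.last hgap hs.first hs.last (.inr hRc)
        (by linarith), hRok, t', by omega, he'⟩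
    · have hR' : span s.placement < span (R :: s.placement) := by
        rw [hspan, hspanR, max_eq_right h2.le]
        linarith
      rcases le_or_gt s.first.size s.last.size with h3 | h3
      · rw [max_eq_right h2.le] at hRok
        obtain ⟨t, ht, he⟩ := exists_eval_placeRight hGRe (e := .var 0)
          (x := R.foot + σ * σ) (.var rfl)
        obtain ⟨t', ht', he'⟩ := hbody (.ifLeFalse (.fst (.snd (.snd (.var rfl)))) (.var rfl) h1
          (.ifLeFalse (.var rfl) (.snd (.snd (.snd (.var rfl)))) h2
          (.ifLeTrue (.fst (.var rfl)) (.fst (.var rfl)) h3 he)))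
        exact ⟨_, R, rfl, rfl, .growEnd s.first s.last L R hgap hs.first hs.last hLc hRc hL' hR'
          (.inr ⟨h3, rfl⟩), hRok, t', by omega, he'⟩
      · rw [min_eq_right h1.le] at hLok
        obtain ⟨t, ht, he⟩ := exists_eval_placeLeft hGLe (e := .var 1)
          (x := L.foot - σ * σ) (.var rfl)
        obtain ⟨t', ht', he'⟩ := hbody (.ifLeFalse (.fst (.snd (.snd (.var rfl)))) (.var rfl) h1
          (.ifLeFalse (.var rfl) (.snd (.snd (.snd (.var rfl)))) h2
          (.ifLeFalse (.fst (.var rfl)) (.fst (.var rfl)) h3 he)))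
        exact ⟨_, L, rfl, rfl, .growEnd s.first s.last L R hgap hs.first hs.last hLc hRc hL' hR'
          (.inl ⟨h3, rfl⟩), hLok, t', by omega, he'⟩

theorem exists_eval_step {s : State} {d σ : ℝ} (hs : s.Ok d) (hσ : 0 < σ) (hσd : σ ≤ d)
    {N : ℕ} (hN : s.placement.length < N) (hN1 : 1 < N) :
    ∃ (s' : State) (D : Disk), s'.placement = D :: s.placement ∧ D.size = σ ∧
      GreedyStep s.placement D ∧ s'.Ok σ ∧ ∃ T ≤ 600 * Nat.log 2 N + 650,
        ∀ {env : List Value} {e : Term} {t : ℕ}, Eval program env e (.pair (.num σ) s.toValue) t →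
          Eval program env (.call 6 e) s'.toValue (t + T) := by
  suffices h : ∃ (s' : State) (D : Disk), s'.placement = D :: s.placement ∧ D.size = σ ∧
      GreedyStep s.placement D ∧ s'.Ok σ ∧ ∃ t ≤ 600 * Nat.log 2 N + 649,
        Eval program [.pair (.num σ) s.toValue] stepBody s'.toValue t by
    obtain ⟨s', D, h1, h2, h3, h4, t, ht, he⟩ := h
    exact ⟨s', D, h1, h2, h3, h4, t + 1, by omega, fun h => .call h rfl he⟩
  obtain ⟨l, hgl, hlp⟩ := hs.gaps
  match hG : s.gaps with
  | .nil =>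
    have hgap : NoGap s.placement σ := fun A B hAB => by
      rw [hG] at hlp
      have := List.map_eq_nil_iff.1 hlp.nil_eq.symm
      have hmem := (hgl.mem_iff A B).2 hAB
      rw [this] at hmem
      simp at hmem
    obtain ⟨s', D, h1, h2, h3, h4, t, ht, he⟩ := exists_eval_stepEnd hs hσ hσd hgap hN hN1
    refine ⟨s', D, h1, h2, h3, h4, _, ?_, .bind (.fst (.snd (.snd (.var rfl))))
      (.ifNilTrue (.var ?_) (.call (.var rfl) rfl he))⟩
    · omega
    · rw [hG]; rfl
  | .node n k v hl hr =>
    have hsv : s.toValue = .pair (encodePlacement s.placement)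
      (.pair (Heap.node n k v hl hr).toValue s.ends) := by rw [State.toValue, hG]
    rcases le_or_gt σ k with hk | hk
    · obtain ⟨s', D, h1, h2, h3, h4, t, ht, he⟩ := exists_eval_stepGap hs hσ hσd hG hk hN hN1
      rw [hsv] at he ⊢
      refine ⟨s', D, h1, h2, h3, h4, _, ?_, .bind (.fst (.snd (.snd (.var rfl))))
        (.ifNilFalse (.var rfl) Heap.toValue_node_ne
          (.ifLeTrue (.fst (.var rfl)) (.fst (.fst (.snd (.var rfl)))) hk
            (.call (.var rfl) rfl he)))⟩
      omega
    -- The root has the largest key, so a root key below `σ` rules out every gap.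
    · have hgap : NoGap s.placement σ := fun A B hAB => by
        have hA := hs.structured.size_pos hAB.1
        have hB := hs.structured.size_pos hAB.2.1
        have hheap := hs.heap
        rw [hG] at hlp hheap
        have hmem := hlp.mem_iff.2 (List.mem_map_of_mem ((hgl.mem_iff A B).2 hAB))
        have hle : (gapEntry (A, B)).1 ≤ k := by
          rcases List.mem_cons.1 hmem with h | h
          · rw [h]
          · exact hheap.2.2.1 _ h
        have hlt := hle.trans_lt hk
        rw [gapEntry, div_lt_iff₀ (by positivity)] at hlt
        rw [fitsBetween_iff hσ hA hB]
        simp only at hlt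
        linarith
      obtain ⟨s', D, h1, h2, h3, h4, t, ht, he⟩ := exists_eval_stepEnd hs hσ hσd hgap hN hN1
      rw [hsv] at he ⊢
      refine ⟨s', D, h1, h2, h3, h4, _, ?_, .bind (.fst (.snd (.snd (.var rfl))))
        (.ifNilFalse (.var rfl) Heap.toValue_node_ne
          (.ifLeFalse (.fst (.var rfl)) (.fst (.fst (.snd (.var rfl)))) hk
            (.call (.var rfl) rfl he)))⟩
      omega

/-! ### The whole program -/

/-- Placed and remaining disks together stay fewer than `N`, which bounds both heaps. Each disk
costs one merge of sizes and at most three merges of gaps, hence the factor `800 = 200 + 600`. -/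
theorem exists_eval_loop {N : ℕ} (hN1 : 1 < N) : ∀ (n : ℕ) (H : Heap) (s : State) (d : ℝ),
    H.toList.length = n → H.Ok → s.Ok d → (∀ x ∈ H.toList, 0 < x.1 ∧ x.1 ≤ d) →
    s.placement.length + n < N →
    ∃ (T : List ℝ) (q : List Disk), T.Perm (H.toList.map Prod.fst) ∧ T.Pairwise (· ≥ ·) ∧
      GreedyFrom s.placement T q ∧ ∃ t ≤ n * (800 * Nat.log 2 N + 800) + 20,
        Eval program [.pair H.toValue s.toValue] loopBody (encodePlacement q) t := by
  intro n
  induction n with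
  | zero =>
    intro H s d hn _ _ _ _
    match H, hn with
    | .nil, _ =>
      exact ⟨[], s.placement, by simp [Heap.toList], .nil, .done _, _, by norm_num,
        .bind (.fst (.var rfl)) (.ifNilTrue (.var rfl) (.fst (.snd (.var rfl))))⟩
  | succ n ih =>
    intro H s d hn hH hs hd hlen
    match H, hn, hH, hd with
    | .node m k v l r, hn, ⟨_, _, hk, hl, hr⟩, hd =>
      simp only [Heap.toList, List.length_cons, List.length_append, add_left_inj] at hn
      obtain ⟨H', hH', hp, T1, hT1, he1⟩ := Heap.exists_eval_call_merge hl hr (N := N)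
        (by omega) (by omega)
      obtain ⟨hk0, hkd⟩ := hd (k, v) (by simp [Heap.toList])
      obtain ⟨s', D, hs'p, rfl, hstep, hs', T2, hT2, he2⟩ :=
        exists_eval_step hs hk0 hkd (N := N) (by omega) hN1
      obtain ⟨T, q, hTp, hT, hG, t, ht, he⟩ := ih H' s' D.size
        (by rw [hp.length_eq, List.length_append, hn]) hH' hs' (fun x hx => by
          have hx' := hp.mem_iff.1 hx
          refine ⟨(hd x ?_).1, hk x hx'⟩
          simp only [Heap.toList, List.mem_cons]
          exact .inr hx') (by rw [hs'p, List.length_cons]; omega)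
      rw [hs'p] at hG
      refine ⟨D.size :: T, q, ?_, List.pairwise_cons.2 ⟨fun x hx => ?_, hT⟩, .place D hstep hG, _,
        ?_, .bind (.fst (.var rfl)) (.ifNilFalse (.var rfl) Heap.toValue_node_ne
          (.call (.pair (he1 (.snd (.snd (.var rfl))))
            (he2 (.pair (.fst (.fst (.snd (.var rfl)))) (.snd (.var rfl))))) rfl he))⟩
      · simp only [Heap.toList, List.map_cons]
        exact (hTp.trans (hp.map _)).cons _
      · obtain ⟨y, hy, rfl⟩ := List.mem_map.1 ((hTp.trans (hp.map _)).mem_iff.1 hx)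
        exact hk y hy
      · rw [add_mul, one_mul]
        omega

theorem exists_eval_build {N : ℕ} (hN1 : 1 < N) : ∀ (S : List ℝ) (H : Heap), H.Ok →
    S.length + H.toList.length < N → ∃ H' : Heap, H'.Ok ∧
      (H'.toList.map Prod.fst).Perm (S ++ H.toList.map Prod.fst) ∧
      ∃ t ≤ S.length * (200 * Nat.log 2 N + 200) + 20,
        Eval program [.pair (encodeSizes S) H.toValue] buildBody H'.toValue t := by
  intro S
  induction S with
  | nil =>
    intro H hH _
    exact ⟨H, hH, by simp, _, by norm_num,
      .bind (.fst (.var rfl)) (.ifNilTrue (.var rfl) (.snd (.var rfl)))⟩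
  | cons x S ih =>
    intro H hH hlen
    rw [List.length_cons] at hlen
    obtain ⟨H1, hH1, hp1, T1, hT1, he1⟩ := Heap.exists_eval_call_merge
      (Heap.singleton_ok x .nil) hH (N := N)
      (by simpa [Heap.singleton, Heap.toList] using hN1) (by omega)
    have hp1' : H1.toList.Perm ((x, .nil) :: H.toList) := by
      simpa [Heap.singleton, Heap.toList] using hp1
    obtain ⟨H2, hH2, hp2, t, ht, he⟩ := ih H1 hH1
      (by rw [hp1'.length_eq, List.length_cons]; omega)
    have hone : ∀ env, Eval program env (.const 1) (.num (1 : ℕ)) 1 := fun env => by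
      rw [Nat.cast_one]; exact .one
    have hne : encodeSizes (x :: S) ≠ .nil := by simp [encodeSizes, Value.ofList]
    refine ⟨H2, hH2, hp2.trans (((hp1'.map Prod.fst).append_left S).trans List.perm_middle), _, ?_,
      .bind (.fst (.var rfl)) (.ifNilFalse (.var rfl) hne
        (.call (.pair (.snd (.var rfl)) (he1 (.pair (.pair (hone _) (.pair
          (.pair (.fst (.var rfl)) .nil) (.pair .nil .nil))) (.snd (.var rfl))))) rfl he))⟩
    rw [List.length_cons, add_mul, one_mul]
    omega

theorem state_ok_singleton {D : Disk} (hD : 0 < D.size) :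
    State.Ok ⟨[D], .nil, D, D, D.leftmostPoint, D.rightmostPoint⟩ D.size := by
  refine ⟨structured_singleton hD, ⟨by simp, by simp⟩, ⟨by simp, by simp⟩,
    ⟨by simp, by simp, by simp, by simp⟩, trivial, [], ⟨.nil, fun A B => ?_, by simp⟩, .nil⟩
  refine iff_of_false (by simp) ?_
  rintro ⟨h1, h2, h3, -⟩
  rw [List.mem_singleton] at h1 h2
  subst h1 h2
  exact lt_irrefl _ h3

theorem exists_outputs {S : List ℝ} (hne : S ≠ []) (hS : ∀ x ∈ S, 0 < x) :
    ∃ (p : List Disk) (t : ℕ), program.Outputs (encodeSizes S) (encodePlacement p) t ∧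
      GreedyOutput S p ∧
      t ≤ S.length * (1000 * Nat.log 2 (S.length + 1) + 1000) +
        (200 * Nat.log 2 (S.length + 1) + 300) := by
  have hlen : 0 < S.length := List.length_pos_iff.2 hne
  set N := S.length + 1
  have hN1 : 1 < N := by omega
  obtain ⟨H, hH, hHp, tb, htb, hb⟩ := exists_eval_build hN1 S .nil trivial
    (by simp [Heap.toList, N])
  rw [Heap.toList, List.map_nil, List.append_nil] at hHp
  have hHlen : H.toList.length = S.length := by simpa using hHp.length_eq
  match H, hH, hHp, hHlen, hb with
  | .nil, _, _, hHlen, _ => simp [Heap.toList] at hHlen; omega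
  | .node m k v l r, ⟨_, _, hk, hl, hr⟩, hHp, hHlen, hb =>
    simp only [Heap.toList, List.length_cons, List.length_append, List.map_cons] at hHlen hHp
    have hpos : ∀ x ∈ (k, v) :: (l.toList ++ r.toList), 0 < x.1 := fun x hx =>
      hS _ (hHp.mem_iff.1 (List.mem_map_of_mem (f := Prod.fst) hx))
    have hk0 : 0 < k := hpos (k, v) (by simp)
    obtain ⟨H', hH', hp, T1, hT1, he1⟩ := Heap.exists_eval_call_merge hl hr (N := N)
      (by omega) (by omega)
    obtain ⟨T, q, hTp, hT, hG, t, ht, he⟩ := exists_eval_loop hN1 _ H' _ k rfl hH'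
      (state_ok_singleton (D := ⟨k, 0⟩) hk0)
      (fun x hx => ⟨hpos x (List.mem_cons_of_mem _ (hp.mem_iff.1 hx)), hk x (hp.mem_iff.1 hx)⟩)
      (by rw [hp.length_eq, List.length_append, List.length_singleton]; omega)
    have hstate : State.toValue ⟨[⟨k, 0⟩], .nil, ⟨k, 0⟩, ⟨k, 0⟩,
        (Disk.mk k 0).leftmostPoint, (Disk.mk k 0).rightmostPoint⟩ =
        .pair (.pair (.pair (.num k) (.num 0)) .nil) (.pair .nil
          (.pair (.pair (.num k) (.num 0)) (.pair (.pair (.num k) (.num 0))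
            (.pair (.num (0 - k * k)) (.num (k * k)))))) := by
      simp only [State.toValue, State.ends, Disk.leftmostPoint, Disk.rightmostPoint, Disk.radius,
        sq, zero_add]
      rfl
    rw [hstate] at he
    have hH'len : H'.toList.length + 1 = S.length := by
      rw [hp.length_eq, List.length_append, hHlen]
    refine ⟨q, _, .call (.var rfl) rfl (.bind (.call (.pair (.var rfl) .nil) rfl hb)
      (.bind (.fst (.fst (.snd (.var rfl)))) (.bind (.pair (.var rfl) .zero)
      (.bind (.arith (o := .mul) (.var rfl) (.var rfl) trivial)
      (.call (.pair (he1 (.snd (.snd (.var rfl)))) (.pair (.pair (.var rfl) .nil)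
        (.pair .nil (.pair (.var rfl) (.pair (.var rfl)
          (.pair (.arith (o := .sub) .zero (.var rfl) trivial) (.var rfl))))))) rfl he))))),
      ⟨k :: T, ?_, List.pairwise_cons.2 ⟨fun x hx => ?_, hT⟩, .place ⟨k, 0⟩ (.first rfl) hG⟩, ?_⟩
    · exact ((hTp.trans (hp.map _)).cons _).trans hHp
    · obtain ⟨y, hy, rfl⟩ := List.mem_map.1 ((hTp.trans (hp.map _)).mem_iff.1 hx)
      exact hk y hy
    · have h1 : H'.toList.length * (800 * Nat.log 2 N + 800) ≤
          S.length * (800 * Nat.log 2 N + 800) := Nat.mul_le_mul_right _ (by omega)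
      have h2 : S.length * (1000 * Nat.log 2 N + 1000) =
          S.length * (800 * Nat.log 2 N + 800) + S.length * (200 * Nat.log 2 N + 200) := by ring
      omega

/-! ### From step counts to `n log n` -/

/-- For `n ≥ 2`, the power of two is at most `n + 1 ≤ n²`, and `log 2 > 1/2`. -/
theorem natLog_succ_le {n : ℕ} (hn : 2 ≤ n) : (Nat.log 2 (n + 1) : ℝ) ≤ 4 * Real.log n := by
  have h0 : (0 : ℝ) < n := by positivity
  have h1 : (2 : ℝ) ^ Nat.log 2 (n + 1) ≤ (n : ℝ) ^ 2 := by
    have h2 := Nat.pow_log_le_self 2 (x := n + 1) (by omega)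
    have h3 : n + 1 ≤ n ^ 2 := by nlinarith
    exact_mod_cast h2.trans h3
  have h2 := Real.log_le_log (by positivity) h1
  rw [Real.log_pow, Real.log_pow] at h2
  push_cast at h2
  have := Real.log_two_gt_d9
  nlinarith [(Nat.log 2 (n + 1)).cast_nonneg (α := ℝ)]

/-- As `n ≥ 2` and `log n ≥ 1/2`, the linear and the additive terms are absorbed by `n log n`. -/
theorem time_le {n t : ℕ} (hn : 2 ≤ n)
    (ht : t ≤ n * (1000 * Nat.log 2 (n + 1) + 1000) + (200 * Nat.log 2 (n + 1) + 300)) :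
    (t : ℝ) ≤ 10000 * (n * Real.log n) := by
  have h1 := natLog_succ_le hn
  have hn' : (2 : ℝ) ≤ n := by exact_mod_cast hn
  have h2 : (1 : ℝ) / 2 ≤ Real.log n := by
    have := Real.log_le_log (by norm_num) hn'
    linarith [Real.log_two_gt_d9]
  have h3 : (t : ℝ) ≤ n * (1000 * Nat.log 2 (n + 1) + 1000) +
      (200 * Nat.log 2 (n + 1) + 300) := by exact_mod_cast ht
  have h4 : (200 * Nat.log 2 (n + 1) + 300 : ℝ) ≤ n / 2 * (200 * Nat.log 2 (n + 1) + 300) :=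
    le_mul_of_one_le_left (by positivity) (by linarith)
  have h5 : (n : ℝ) * Nat.log 2 (n + 1) ≤ n * (4 * Real.log n) :=
    mul_le_mul_of_nonneg_left h1 (by positivity)
  have h6 : (n : ℝ) * (1 / 2) ≤ n * Real.log n := mul_le_mul_of_nonneg_left h2 (by positivity)
  nlinarith

end Shelf

theorem theorem5p1 :
    (∀ (S : List ℝ) (p : List Shelf.Disk), S ≠ [] → (∀ s ∈ S, 0 < s) →
      Shelf.GreedyOutput S p → Shelf.IsApproximation (4 / 3) S p) ∧
    (∃ (P : Shelf.Program) (C : ℝ), ∀ S : List ℝ, S ≠ [] → (∀ s ∈ S, 0 < s) →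
      ∃ (p : List Shelf.Disk) (t : ℕ),
        P.Outputs (Shelf.encodeSizes S) (Shelf.encodePlacement p) t ∧
        Shelf.GreedyOutput S p ∧
        (2 ≤ S.length → (t : ℝ) ≤ C * (S.length * Real.log S.length))) := by
  refine ⟨fun S p hne hS h => h.isApproximation hne hS, Shelf.program, 10000, fun S hne hS => ?_⟩
  obtain ⟨p, t, h1, h2, h3⟩ := Shelf.exists_outputs hne hS
  exact ⟨p, t, h1, h2, fun hn => Shelf.time_le hn h3⟩
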